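/- Let $\alpha>0$ be a real number and let $\Delta\ge 0$ and $d\ge 1$ be integers. For a finite graph $H$ let $d(H)=\max\{2|E(K)|/|V(K)| : K\subseteq H,\ V(K)\neq\emptyset\}$ be its maximum density, and let $\mathcal H(n,\Delta,d)$ be the family of all graphs on $n$ vertices with maximum degree at most $\Delta$ and maximum density at most $d$. Let $\mathcal G_c(n,p)$ denote the binomial random graph $\mathcal G(n,p)$ in which every edge is coloured, independently and uniformly at random, with one of the $c\ge 1$ colours $1,\dots,c$. A rainbow copy of $H$ in an edge-coloured graph is a subgraph isomorphic to $H$ whose edges have pairwise distinct colours. For every $\varepsilon>0$ there is $n_0=n_0(\alpha,\Delta,d,\varepsilon)$ such that the following holds for all $n\ge n_0$, all $H\in\mathcal H(n,\Delta,d)$ with at least one edge, all $p\in[0,1]$ with $p\ge n^{-1/d}(\log n)^{5/d}$ ($\log$ is the natural logarithm), and $c=(1+\alpha)|E(H)|$, rounded to an integer in either direction: $G\sim\mathcal G_c(n,p)$ contains a rainbow copy of $H$ with probability at least $1-\varepsilon$. -/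

import Mathlib

open MeasureTheory ProbabilityTheory

namespace RainbowEmbedding

/-- The maximum density of a finite graph: the maximum of `2|E(K)| / |V(K)|` over its subgraphs `K`
(the supremum of a finite, nonempty set of reals; the subgraph without vertices contributes
`0 / 0 = 0`, which does not affect it). -/
noncomputable def maxDensity {V : Type*} [Finite V] (H : SimpleGraph V) : ℝ :=
  ⨆ K : H.Subgraph, 2 * (K.edgeSet.ncard : ℝ) / (K.verts.ncard : ℝ)

open Classical in
/-- The family of all graphs on `n` vertices with maximum degree at most `Δ` and maximum density at
most `d`. -/
noncomputable def boundedFamily (n Δ d : ℕ) : Set (SimpleGraph (Fin n)) :=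
  {H | H.maxDegree ≤ Δ ∧ maxDensity H ≤ (d : ℝ)}

/-- Independent uniform colours from a set of `c` colours, one for every unordered pair. -/
noncomputable def uniformColouring (n c : ℕ) : Measure (Sym2 (Fin n) → Fin c) :=
  Measure.pi fun _ => uniformOn (Set.univ : Set (Fin c))

/-- The random edge-coloured graph with `c` colours: a binomial random graph `G` with edge
probability `p`, and, independently of it, independent uniform colours. Only the colours of the
pairs that are edges of `G` are ever looked at. -/
noncomputable def colouredBinomialRandom (n : ℕ) (p : unitInterval) (c : ℕ) :
    Measure (SimpleGraph (Fin n) × (Sym2 (Fin n) → Fin c)) :=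
  (SimpleGraph.binomialRandom (Fin n) p).prod (uniformColouring n c)

/-- `G`, with its edges coloured by `col`, contains a rainbow copy of `H`: an injective map of the
vertices that sends the edges of `H` to edges of `G` of pairwise distinct colours. -/
def HasRainbowCopy {V W C : Type*} (H : SimpleGraph V) (G : SimpleGraph W) (col : Sym2 W → C) :
    Prop :=
  ∃ f : SimpleGraph.Copy H G, Set.InjOn (fun e : Sym2 V => col (e.map f)) H.edgeSet

end RainbowEmbedding

/-! Fix an injection `j` of the edges of H into the colours. A permutation of the vertices and one
of the colours turn H into a coloured copy, a set of (pair, colour) elements whose colours are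
distinct. It is enough that the random coloured graph contains one of these sets, and that follows
from the family being spread.

Spreadness (`card_colouredCopy_superset_le`): s prescribed coloured edges lie in at most a (C
n^(-2/(d+1)) / c)^s fraction of the copies. Each colour costs a factor 3/c. For the vertices,
bounded degree leaves n choices for one vertex per component of the prescribed edges and boundedly
many for the others, so every vertex beyond the first of its component gains 1/n. A component on u
vertices has at most min(u(u-1)/2, du/2) ≤ (d+1)(u-1)/2 edges, hence the gain of n^(-2/(d+1)) per
edge.

The spread lemma `card_mul_fail_le` finds a copy in a union of r = O(log n) random subsets of pairs
× colours. There a pair may carry several colours, in the coloured graph at most one. Since a copy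
uses each pair at most once, pairs can be exchanged one at a time (`sum_prod_hit_le`): only the
chance to hit a colour set D counts, which is at most |D|p/c before and exactly |D|p/c after.

The required p is of order n^(-2/(d+1)) (log n)^3. This is polynomially below n^(-1/d) if d ≥ 2; if
d = 1 the powers of n agree and (log n)^5 wins. -/

namespace RainbowEmbedding

open Finset

/-- The probability that a random subset, which contains every element independently with
probability `p`, equals `W`. -/
noncomputable def subsetWeight {X : Type*} [Fintype X] [DecidableEq X] (p : ℝ) (W : Finset X) : ℝ :=
  ∏ x, if x ∈ W then p else 1 - p

/-! ### The spread lemma, by minimum fragments. -/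

section Spread

variable {X ι : Type*} [DecidableEq X] {p q M m : ℝ}

/-- A choice of minimum fragments: `T i W` is a smallest set of the form `F j \ W` with
`F j ⊆ F i ∪ W`, and it is contained in any member of the family inside `W ∪ T i W`. -/
lemma exists_minimum_fragment (I : Finset ι) (F : ι → Finset X) :
    ∃ T : ι → Finset X → Finset X, ∀ i ∈ I, ∀ W,
      T i W ⊆ F i ∧ (∃ j ∈ I, T i W = F j \ W) ∧ ∀ j ∈ I, F j ⊆ W ∪ T i W → T i W ⊆ F j := by
  have key : ∀ (i : ι) (W : Finset X), ∃ T : Finset X, i ∈ I →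
      T ⊆ F i ∧ (∃ j ∈ I, T = F j \ W) ∧ ∀ j ∈ I, F j ⊆ W ∪ T → T ⊆ F j := by
    intro i W
    by_cases hi : i ∈ I
    · obtain ⟨j, hj, hmin⟩ := exists_min_image (I.filter fun j => F j ⊆ F i ∪ W)
        (fun j => #(F j \ W)) ⟨i, by simp [hi]⟩
      rw [mem_filter] at hj
      have hT : F j \ W ⊆ F i := by
        intro x hx
        have := hj.2 (mem_sdiff.mp hx).1
        simp only [mem_union, mem_sdiff] at this hx
        tauto
      refine ⟨F j \ W, fun _ => ⟨hT, ⟨j, hj.1, rfl⟩, fun j' hj' hsub => ?_⟩⟩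
      -- `F j'` also competes in the minimum, so its part outside `W` cannot be a proper subset of
      -- the fragment.
      have h1 : F j' \ W ⊆ F j \ W := by
        intro x hx
        have := hsub (mem_sdiff.mp hx).1
        simp only [mem_union, mem_sdiff] at this hx ⊢
        tauto
      have h2 : F j' ⊆ F i ∪ W := by
        intro x hx
        have := hsub hx
        rw [mem_union] at this ⊢
        exact this.elim Or.inr fun h => Or.inl (hT h)
      have h3 := hmin j' (by simp [hj', h2])
      rw [← eq_of_subset_of_card_le h1 h3]
      exact sdiff_subset
    · exact ⟨∅, fun h => absurd h hi⟩
  choose T hT using key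
  exact ⟨T, fun i hi W => hT i W hi⟩

variable [Fintype X]

lemma subsetWeight_nonneg (hp0 : 0 ≤ p) (hp1 : p ≤ 1) (W : Finset X) : 0 ≤ subsetWeight p W :=
  prod_nonneg fun x _ => by split_ifs <;> linarith

lemma sum_subsetWeight (p : ℝ) : ∑ W : Finset X, subsetWeight p W = 1 := by
  have h := Finset.prod_add (fun _ : X => p) (fun _ => 1 - p) univ
  simp only [add_sub_cancel, prod_const_one, powerset_univ] at h
  rw [h]
  refine sum_congr rfl fun W _ => ?_
  rw [subsetWeight, prod_ite]
  congr 1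
  · simp
  · refine prod_congr ?_ fun _ _ => rfl
    ext; simp

/-- Each element of `T` has factor `1 - p ≤ 1` in the weight of `W` and `p` in that of `W ∪ T`. -/
lemma pow_mul_subsetWeight_le (hp0 : 0 ≤ p) (hp1 : p ≤ 1) {W T : Finset X} (h : Disjoint T W) :
    p ^ #T * subsetWeight p W ≤ subsetWeight p (W ∪ T) := by
  have : p ^ #T = ∏ x : X, if x ∈ T then p else 1 := by
    rw [prod_ite]; simp
  rw [this, subsetWeight, subsetWeight, ← prod_mul_distrib]
  refine prod_le_prod (fun x _ => ?_) fun x _ => ?_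
  · refine mul_nonneg ?_ ?_ <;> split_ifs <;> linarith
  · by_cases hT : x ∈ T
    · have hW : x ∉ W := fun hW => (Finset.disjoint_left.mp h hT hW)
      simp only [hT, hW, mem_union, if_true, if_false, or_true]
      nlinarith
    · simp [hT]

/-- In one round of exposure, only few members of a spread family keep a fragment of more than half
the size. -/
lemma exists_fragment (hp0 : 0 < p) (hp1 : p ≤ 1) (hm : 1 ≤ m) (hq : 0 ≤ q)
    (hpq : 4 * m ^ 2 * q ≤ p) (I : Finset ι) (F : ι → Finset X) {k : ℕ} (hk0 : k ≠ 0)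
    (hk : ∀ i ∈ I, #(F i) ≤ k)
    (hspread : ∀ A : Finset X, (#{i ∈ I | A ⊆ F i} : ℝ) ≤ q ^ #A * M) :
    ∃ T : ι → Finset X → Finset X,
      (∀ i ∈ I, ∀ W, T i W ⊆ F i ∧ ∃ j ∈ I, T i W = F j \ W) ∧
      ∑ W, subsetWeight p W * (#{i ∈ I | k < 2 * #(T i W)} : ℝ) ≤ M / m := by
  classical
  obtain ⟨T, hT⟩ := exists_minimum_fragment I F
  refine ⟨T, fun i hi W => ⟨(hT i hi W).1, (hT i hi W).2.1⟩, ?_⟩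
  have hM : 0 ≤ M := by simpa using (Nat.cast_nonneg _).trans (hspread ∅)
  -- `S Z` is a member inside `Z`, chosen from `Z` alone. The fragment lies in every member inside
  -- `W ∪ T`, so knowing `Z = W ∪ T` leaves at most `2 ^ k` choices for it.
  have hS : ∀ Z : Finset X, ∃ S : Finset X, #S ≤ k ∧
      ((∃ j ∈ I, F j ⊆ Z) → ∃ j ∈ I, F j ⊆ Z ∧ S = F j) := by
    intro Z
    by_cases h : ∃ j ∈ I, F j ⊆ Z
    · obtain ⟨j, hj, hZ⟩ := h
      exact ⟨F j, hk j hj, fun _ => ⟨j, hj, hZ, rfl⟩⟩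
    · exact ⟨∅, by simp, fun h' => absurd h' h⟩
  choose S hSk hS using hS
  have hTS : ∀ i ∈ I, ∀ W, T i W ⊆ S (W ∪ T i W) := by
    intro i hi W
    obtain ⟨h1, ⟨j, hj, hTj⟩, h3⟩ := hT i hi W
    have : F j ⊆ W ∪ T i W := by
      intro x hx
      rw [hTj, mem_union, mem_sdiff]
      tauto
    obtain ⟨j', hj', hsub, hSj'⟩ := hS (W ∪ T i W) ⟨j, hj, this⟩
    rw [hSj']
    exact h3 j' hj' hsub
  have hdisj : ∀ i ∈ I, ∀ W, Disjoint (T i W) W := by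
    intro i hi W
    obtain ⟨-, ⟨j, hj, hTj⟩, -⟩ := hT i hi W
    rw [hTj]
    exact sdiff_disjoint
  have hw := fun W : Finset X => subsetWeight_nonneg hp0.le hp1 W
  -- the encoding of `(W, T)` by `(W ∪ T, T)`
  have step : ∀ i ∈ I, ∑ W, subsetWeight p W * (if k < 2 * #(T i W) then 1 else 0) ≤
      ∑ A : Finset X, ∑ Z : Finset X,
        (if k < 2 * #A ∧ A ⊆ S Z ∧ A ⊆ F i then subsetWeight p Z * (p⁻¹) ^ #A else 0) := by
    intro i hi
    calc ∑ W, subsetWeight p W * (if k < 2 * #(T i W) then 1 else 0)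
        = ∑ W, ∑ A : Finset X, (if T i W = A then
            (if k < 2 * #A then subsetWeight p W else 0) else 0) := by
          refine sum_congr rfl fun W _ => ?_
          rw [Finset.sum_ite_eq]
          simp
      _ = ∑ A : Finset X, ∑ W, (if T i W = A then
            (if k < 2 * #A then subsetWeight p W else 0) else 0) := sum_comm
      _ ≤ _ := sum_le_sum fun A _ => ?_
    by_cases hkA : k < 2 * #A
    swap
    · simp [hkA]
    simp only [hkA, if_true, true_and]
    rw [← sum_filter, ← sum_filter]
    calc ∑ W with T i W = A, subsetWeight p W
        ≤ ∑ W with T i W = A, subsetWeight p (W ∪ A) * (p⁻¹) ^ #A := by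
          refine sum_le_sum fun W hW => ?_
          rw [mem_filter] at hW
          have := pow_mul_subsetWeight_le hp0.le hp1 (hW.2 ▸ hdisj i hi W)
          rw [inv_pow, ← div_eq_mul_inv, le_div_iff₀ (pow_pos hp0 _)]
          linarith
      _ = ∑ Z ∈ ({W | T i W = A} : Finset (Finset X)).image (· ∪ A),
            subsetWeight p Z * (p⁻¹) ^ #A := by
          rw [sum_image]
          intro W hW W' hW' h
          simp only [coe_filter, mem_univ, true_and, Set.mem_ofPred_eq] at hW hW'
          have e1 := hW ▸ hdisj i hi W
          have e2 := hW' ▸ hdisj i hi W'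
          have := congrArg (· \ A) h
          simpa [union_sdiff_distrib, e1.symm.sdiff_eq_left, e2.symm.sdiff_eq_left] using this
      _ ≤ _ := by
          refine sum_le_sum_of_subset_of_nonneg ?_ fun Z _ _ =>
            mul_nonneg (hw Z) (pow_nonneg (inv_nonneg.mpr hp0.le) _)
          intro Z hZ
          simp only [mem_image, mem_filter, mem_univ, true_and] at hZ ⊢
          obtain ⟨W, hW, rfl⟩ := hZ
          subst hW
          exact ⟨hTS i hi W, (hT i hi W).1⟩
  have hm0 : 0 < m := by linarith
  -- Large fragments gain `(2m)^(-k)`; the part `2^(-k)` pays for the choice of `A` inside `S Z`.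
  have hterm : ∀ A : Finset X, k < 2 * #A → (p⁻¹) ^ #A * q ^ #A ≤ (1 / (2 * m)) ^ k := by
    intro A hA
    have h1 : p⁻¹ * q ≤ (1 / (2 * m)) ^ 2 := by
      rw [div_pow, one_pow, inv_mul_eq_div, div_le_div_iff₀ hp0 (by positivity)]
      nlinarith
    rw [← mul_pow]
    calc (p⁻¹ * q) ^ #A ≤ ((1 / (2 * m)) ^ 2) ^ #A :=
          pow_le_pow_left₀ (by positivity) h1 _
      _ = (1 / (2 * m)) ^ (2 * #A) := by rw [pow_mul]
      _ ≤ _ := pow_le_pow_of_le_one (by positivity)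
          (by rw [div_le_one (by positivity)]; linarith) hA.le
  calc ∑ W, subsetWeight p W * (#{i ∈ I | k < 2 * #(T i W)} : ℝ)
      = ∑ i ∈ I, ∑ W, subsetWeight p W * (if k < 2 * #(T i W) then 1 else 0) := by
        rw [sum_comm]
        refine sum_congr rfl fun W _ => ?_
        rw [← mul_sum]
        simp
    _ ≤ ∑ i ∈ I, ∑ A : Finset X, ∑ Z : Finset X,
        (if k < 2 * #A ∧ A ⊆ S Z ∧ A ⊆ F i then subsetWeight p Z * (p⁻¹) ^ #A else 0) :=
        sum_le_sum step
    _ = ∑ Z : Finset X, ∑ A : Finset X, ∑ i ∈ I,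
        (if k < 2 * #A ∧ A ⊆ S Z ∧ A ⊆ F i then subsetWeight p Z * (p⁻¹) ^ #A else 0) := by
        rw [sum_comm, sum_congr rfl fun A _ => sum_comm (s := I)]
        exact sum_comm
    _ ≤ ∑ Z : Finset X, ∑ A ∈ (S Z).powerset, subsetWeight p Z * ((1 / (2 * m)) ^ k * M) := by
        refine sum_le_sum fun Z _ => ?_
        rw [← Finset.sum_subset (subset_univ (S Z).powerset)]
        · refine sum_le_sum fun A hA => ?_
          rw [mem_powerset] at hA
          by_cases hkA : k < 2 * #A
          · simp only [hkA, hA, true_and]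
            rw [← sum_filter, sum_const, nsmul_eq_mul]
            calc (#{i ∈ I | A ⊆ F i} : ℝ) * (subsetWeight p Z * p⁻¹ ^ #A)
                ≤ (q ^ #A * M) * (subsetWeight p Z * p⁻¹ ^ #A) :=
                  mul_le_mul_of_nonneg_right (hspread A)
                    (mul_nonneg (hw Z) (pow_nonneg (inv_nonneg.mpr hp0.le) _))
              _ = subsetWeight p Z * ((p⁻¹ ^ #A * q ^ #A) * M) := by ring
              _ ≤ _ := mul_le_mul_of_nonneg_left
                  (mul_le_mul_of_nonneg_right (hterm A hkA) hM) (hw Z)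
          · simp only [hkA, false_and, if_false, sum_const_zero]
            exact mul_nonneg (hw Z) (by positivity)
        · intro A _ hA
          rw [mem_powerset] at hA
          simp [hA]
    _ ≤ ∑ Z : Finset X, subsetWeight p Z * (M / m) := by
        refine sum_le_sum fun Z _ => ?_
        rw [sum_const, nsmul_eq_mul, card_powerset]
        have h2 : ((2 ^ #(S Z) : ℕ) : ℝ) ≤ 2 ^ k := by
          push_cast
          exact pow_le_pow_right₀ (by norm_num) (hSk Z)
        have h3 : (2 : ℝ) ^ k * ((1 / (2 * m)) ^ k * M) ≤ M / m := by
          rw [← mul_assoc, ← mul_pow]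
          have : (2 : ℝ) * (1 / (2 * m)) = 1 / m := by field_simp
          rw [this, div_eq_mul_one_div M m, mul_comm]
          refine mul_le_mul_of_nonneg_left ?_ hM
          exact pow_le_of_le_one (by positivity) (by rw [div_le_one hm0]; exact hm) hk0
        calc ((2 ^ #(S Z) : ℕ) : ℝ) * (subsetWeight p Z * ((1 / (2 * m)) ^ k * M))
            ≤ 2 ^ k * (subsetWeight p Z * ((1 / (2 * m)) ^ k * M)) :=
              mul_le_mul_of_nonneg_right h2 (mul_nonneg (hw Z) (by positivity))
          _ = subsetWeight p Z * (2 ^ k * ((1 / (2 * m)) ^ k * M)) := by ring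
          _ ≤ _ := mul_le_mul_of_nonneg_left h3 (hw Z)
    _ = M / m := by rw [← sum_mul, sum_subsetWeight, one_mul]

lemma sum_prod_subsetWeight (p : ℝ) (r : ℕ) :
    ∑ Ws : Fin r → Finset X, ∏ j, subsetWeight p (Ws j) = 1 := by
  rw [← Fintype.piFinset_univ, ← Finset.prod_univ_sum]
  simp [sum_subsetWeight]

open Classical in
/-- **Spread lemma.** A spread family of sets of size less than `2 ^ r` has a member inside the union
of `r` independent random sets, with high probability. -/
theorem card_mul_fail_le (hp0 : 0 < p) (hp1 : p ≤ 1) (hm : 1 ≤ m) (hq : 0 ≤ q)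
    (hpq : 4 * m ^ 2 * q ≤ p) (r : ℕ) (I : Finset ι) (F : ι → Finset X) {k : ℕ} (hkr : k < 2 ^ r)
    (hk : ∀ i ∈ I, #(F i) ≤ k)
    (hspread : ∀ A : Finset X, (#{i ∈ I | A ⊆ F i} : ℝ) ≤ q ^ #A * M) :
    (#I : ℝ) * ∑ Ws : Fin r → Finset X, (∏ j, subsetWeight p (Ws j)) *
      (if ∃ i ∈ I, F i ⊆ univ.biUnion Ws then 0 else 1) ≤ r * (M / m) := by
  have hm0 : 0 < m := by linarith
  have hw := fun W : Finset X => subsetWeight_nonneg hp0.le hp1 W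
  induction r generalizing I F k with
  | zero =>
    have hk0 : k = 0 := by simpa using hkr
    subst hk0
    rcases I.eq_empty_or_nonempty with rfl | ⟨i, hi⟩
    · simp
    · have : ∃ i ∈ I, F i = ∅ := ⟨i, hi, by simpa using hk i hi⟩
      simp [this]
  | succ r ih =>
    have hM : 0 ≤ M := by simpa using (Nat.cast_nonneg _).trans (hspread ∅)
    rcases Nat.eq_zero_or_pos k with rfl | hkpos
    · rcases I.eq_empty_or_nonempty with rfl | ⟨i, hi⟩
      · simp; positivity
      · have : ∀ Ws : Fin (r + 1) → Finset X, ∃ i ∈ I, F i ⊆ univ.biUnion Ws :=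
          fun Ws => ⟨i, hi, by simp [card_eq_zero.mp (Nat.le_zero.mp (hk i hi))]⟩
        simp only [this, if_true, mul_zero, sum_const_zero]
        positivity
    obtain ⟨T, hT, hbad⟩ := exists_fragment hp0 hp1 hm hq hpq I F hkpos.ne' hk hspread
    have hsplit : ∀ W, (#I : ℝ) * ∑ Ws : Fin r → Finset X, (∏ j, subsetWeight p (Ws j)) *
        (if ∃ i ∈ I, F i ⊆ univ.biUnion (Fin.cons W Ws : Fin (r + 1) → Finset X) then 0 else 1) ≤
        #{i ∈ I | k < 2 * #(T i W)} + r * (M / m) := by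
      intro W
      set s := ∑ Ws : Fin r → Finset X, (∏ j, subsetWeight p (Ws j)) *
        (if ∃ i ∈ I, F i ⊆ univ.biUnion (Fin.cons W Ws : Fin (r + 1) → Finset X) then 0 else 1 : ℝ)
        with hs
      have hs1 : s ≤ 1 := by
        rw [← sum_prod_subsetWeight (X := X) p r, hs]
        refine sum_le_sum fun Ws _ => ?_
        refine mul_le_of_le_one_right (prod_nonneg fun j _ => hw _) ?_
        split_ifs <;> norm_num
      -- Fragments are subsets of the members, so they are spread with the same `q` and the same
      -- `M`, although the index set shrinks.
      have hIH := ih {i ∈ I | ¬ k < 2 * #(T i W)} (fun i => T i W) (k := k / 2)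
        (by rw [pow_succ] at hkr; omega)
        (fun i hi => by rw [mem_filter] at hi; omega)
        (fun A => le_trans (by
          gcongr
          intro i hi
          simp only [mem_filter] at hi ⊢
          exact ⟨hi.1.1, hi.2.trans (hT i hi.1.1 W).1⟩) (hspread A))
      -- A fragment is `F j \ W` for some member, so covering it in the later rounds covers `F j`
      -- together with `W`.
      have hs2 : s ≤ ∑ Ws : Fin r → Finset X, (∏ j, subsetWeight p (Ws j)) *
          (if ∃ i ∈ ({i ∈ I | ¬ k < 2 * #(T i W)} : Finset ι), T i W ⊆ univ.biUnion Ws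
            then 0 else 1) := by
        refine sum_le_sum fun Ws _ => mul_le_mul_of_nonneg_left ?_ (prod_nonneg fun j _ => hw _)
        by_cases h : ∃ i ∈ ({i ∈ I | ¬ k < 2 * #(T i W)} : Finset ι), T i W ⊆ univ.biUnion Ws
        · obtain ⟨i, hi, hsub⟩ := h
          obtain ⟨-, j, hj, hTj⟩ := hT i (mem_filter.mp hi).1 W
          have : ∃ i ∈ I, F i ⊆ univ.biUnion (Fin.cons W Ws : Fin (r + 1) → Finset X) := by
            refine ⟨j, hj, fun x hx => ?_⟩
            by_cases hxW : x ∈ W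
            · exact mem_biUnion.mpr ⟨0, mem_univ _, by simpa using hxW⟩
            · have : x ∈ T i W := by rw [hTj, mem_sdiff]; exact ⟨hx, hxW⟩
              obtain ⟨l, -, hl⟩ := mem_biUnion.mp (hsub this)
              exact mem_biUnion.mpr ⟨l.succ, mem_univ _, by simpa using hl⟩
          rw [if_pos this]
          split_ifs <;> norm_num
        · rw [if_neg h]
          split_ifs <;> norm_num
      have hcard : (#I : ℝ) = #{i ∈ I | k < 2 * #(T i W)} + #{i ∈ I | ¬ k < 2 * #(T i W)} := by
        exact_mod_cast (card_filter_add_card_filter_not _).symm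
      rw [hcard, add_mul]
      refine add_le_add (mul_le_of_le_one_right (Nat.cast_nonneg _) hs1) (le_trans ?_ hIH)
      exact mul_le_mul_of_nonneg_left hs2 (Nat.cast_nonneg _)
    rw [← (Fin.consEquiv fun _ : Fin (r + 1) => Finset X).sum_comp, Fintype.sum_prod_type, mul_sum]
    calc ∑ W, (#I : ℝ) * ∑ Ws : Fin r → Finset X, (∏ j, subsetWeight p
            (Fin.consEquiv (fun _ : Fin (r + 1) => Finset X) (W, Ws) j)) * (if ∃ i ∈ I, F i ⊆
            univ.biUnion (Fin.consEquiv (fun _ : Fin (r + 1) => Finset X) (W, Ws)) then 0 else 1)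
        = ∑ W, subsetWeight p W * ((#I : ℝ) * ∑ Ws : Fin r → Finset X,
          (∏ j, subsetWeight p (Ws j)) * (if ∃ i ∈ I,
            F i ⊆ univ.biUnion (Fin.cons W Ws : Fin (r + 1) → Finset X) then 0 else 1)) := by
          refine sum_congr rfl fun W _ => ?_
          rw [mul_left_comm (subsetWeight p W)]
          refine congrArg _ ?_
          rw [mul_sum]
          refine sum_congr rfl fun Ws _ => ?_
          simp only [Fin.consEquiv, Equiv.coe_fn_mk, Fin.prod_univ_succ, Fin.cons_zero,
            Fin.cons_succ, mul_assoc]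
          congr!
      _ ≤ ∑ W, subsetWeight p W * (#{i ∈ I | k < 2 * #(T i W)} + r * (M / m)) :=
          sum_le_sum fun W _ => mul_le_mul_of_nonneg_left (hsplit W) (hw W)
      _ = (∑ W, subsetWeight p W * (#{i ∈ I | k < 2 * #(T i W)} : ℝ)) + r * (M / m) := by
          simp only [mul_add, sum_add_distrib, ← sum_mul, sum_subsetWeight, one_mul]
      _ ≤ M / m + r * (M / m) := by gcongr
      _ = _ := by push_cast; ring

end Spread

/-! ### Exchanging independent coordinates one at a time. -/

section Coupling

variable {A B C : Type*} [Fintype A] [Fintype B]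

lemma sum_mul_indicator_mono {α : Type*} [Fintype α] {μ : α → ℝ} (hμ : ∀ a, 0 ≤ μ a)
    {P Q : α → Prop} [DecidablePred P] [DecidablePred Q] (h : ∀ a, P a → Q a) :
    ∑ a, μ a * (if P a then 1 else 0) ≤ ∑ a, μ a * (if Q a then 1 else 0) := by
  refine sum_le_sum fun a _ => mul_le_mul_of_nonneg_left ?_ (hμ a)
  by_cases hP : P a
  · simp [hP, h a hP]
  · simp only [hP, if_false]
    split_ifs <;> norm_num

open Classical in
/-- If in every coordinate a random element of `B` is at least as likely to hit a given set as a
random element of `A`, then the same is true for the probability to contain a member of a given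
family of partial functions; `Fin m` as the index set. -/
lemma sum_prod_hit_le_fin {m : ℕ} {RA : A → C → Prop} {RB : B → C → Prop}
    {μ : Fin m → A → ℝ} {ν : Fin m → B → ℝ}
    (hμ : ∀ e a, 0 ≤ μ e a) (hν : ∀ e b, 0 ≤ ν e b)
    (hμ1 : ∀ e, ∑ a, μ e a = 1) (hν1 : ∀ e, ∑ b, ν e b = 1) (F : Set (Fin m → Option C))
    (h : ∀ e, (∃ S ∈ F, S e ≠ none) → ∀ D : Set C,
      ∑ a, μ e a * (if ∃ c ∈ D, RA a c then 1 else 0) ≤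
        ∑ b, ν e b * (if ∃ c ∈ D, RB b c then 1 else 0)) :
    ∑ a : Fin m → A, (∏ e, μ e (a e)) *
        (if ∃ S ∈ F, ∀ e c, S e = some c → RA (a e) c then 1 else 0) ≤
      ∑ b : Fin m → B, (∏ e, ν e (b e)) *
        (if ∃ S ∈ F, ∀ e c, S e = some c → RB (b e) c then 1 else 0) := by
  induction m with
  | zero => simp
  | succ m ih =>
    have hsumA : ∀ f : (Fin (m + 1) → A) → ℝ,
        ∑ a, f a = ∑ a' : Fin m → A, ∑ a₀, f (Fin.cons a₀ a') := fun f => by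
      rw [← (Fin.consEquiv fun _ : Fin (m + 1) => A).sum_comp, Fintype.sum_prod_type, sum_comm]
      rfl
    have hsumB : ∀ f : (Fin (m + 1) → B) → ℝ,
        ∑ b, f b = ∑ b₀, ∑ b' : Fin m → B, f (Fin.cons b₀ b') := fun f => by
      rw [← (Fin.consEquiv fun _ : Fin (m + 1) => B).sum_comp, Fintype.sum_prod_type]
      rfl
    -- replace the first coordinate
    have first : ∀ a' : Fin m → A,
        ∑ a₀, μ 0 a₀ * (if ∃ S ∈ F, (∀ c, S 0 = some c → RA a₀ c) ∧
          ∀ (e : Fin m) c, S e.succ = some c → RA (a' e) c then 1 else 0) ≤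
        ∑ b₀, ν 0 b₀ * (if ∃ S ∈ F, (∀ c, S 0 = some c → RB b₀ c) ∧
          ∀ (e : Fin m) c, S e.succ = some c → RA (a' e) c then 1 else 0) := by
      intro a'
      -- With the other coordinates fixed, either some satisfied `S` leaves coordinate 0 free and
      -- both events are certain, or the event is that coordinate 0 hits a fixed set `D`.
      by_cases hN : ∃ S ∈ F, S 0 = none ∧ ∀ (e : Fin m) c, S e.succ = some c → RA (a' e) c
      · obtain ⟨S, hS, h0, ht⟩ := hN
        have hA : ∀ a₀, ∃ S ∈ F, (∀ c, S 0 = some c → RA a₀ c) ∧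
            ∀ (e : Fin m) c, S e.succ = some c → RA (a' e) c := fun _ => ⟨S, hS, by simp [h0], ht⟩
        have hB : ∀ b₀, ∃ S ∈ F, (∀ c, S 0 = some c → RB b₀ c) ∧
            ∀ (e : Fin m) c, S e.succ = some c → RA (a' e) c := fun _ => ⟨S, hS, by simp [h0], ht⟩
        simp only [hA, hB, if_true, mul_one, hμ1, hν1, le_refl]
      · by_cases hsupp : ∃ S ∈ F, S 0 ≠ none
        · set D : Set C := {c | ∃ S ∈ F, S 0 = some c ∧
            ∀ (e : Fin m) c, S e.succ = some c → RA (a' e) c} with hD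
          refine (sum_mul_indicator_mono (hμ 0) ?_).trans
            ((h 0 hsupp D).trans (sum_mul_indicator_mono (hν 0) ?_))
          · rintro a₀ ⟨S, hS, h0, ht⟩
            cases hc : S 0 with
            | none => exact absurd ⟨S, hS, hc, ht⟩ hN
            | some c => exact ⟨c, ⟨S, hS, hc, ht⟩, h0 c hc⟩
          · rintro b₀ ⟨c, ⟨S, hS, hc, ht⟩, hR⟩
            refine ⟨S, hS, fun c' hc' => ?_, ht⟩
            rw [hc, Option.some_inj] at hc'
            exact hc' ▸ hR
        · have : ∀ a₀, ¬ ∃ S ∈ F, (∀ c, S 0 = some c → RA a₀ c) ∧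
              ∀ (e : Fin m) c, S e.succ = some c → RA (a' e) c := by
            rintro a₀ ⟨S, hS, h0, ht⟩
            exact hN ⟨S, hS, by_contra fun h' => hsupp ⟨S, hS, h'⟩, ht⟩
          simp only [this, if_false, mul_zero, sum_const_zero]
          exact sum_nonneg fun b₀ _ => mul_nonneg (hν 0 b₀) (by split_ifs <;> norm_num)
    -- and then the others
    have others : ∀ b₀ : B,
        ∑ a' : Fin m → A, (∏ e : Fin m, μ e.succ (a' e)) *
          (if ∃ S ∈ F, (∀ c, S 0 = some c → RB b₀ c) ∧
            ∀ (e : Fin m) c, S e.succ = some c → RA (a' e) c then 1 else 0) ≤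
        ∑ b' : Fin m → B, (∏ e : Fin m, ν e.succ (b' e)) *
          (if ∃ S ∈ F, (∀ c, S 0 = some c → RB b₀ c) ∧
            ∀ (e : Fin m) c, S e.succ = some c → RB (b' e) c then 1 else 0) := by
      intro b₀
      have := ih (μ := fun e => μ e.succ) (ν := fun e => ν e.succ) (fun e => hμ _) (fun e => hν _)
        (fun e => hμ1 _) (fun e => hν1 _)
        ((fun S : Fin (m + 1) → Option C => fun e : Fin m => S e.succ) ''
          {S | S ∈ F ∧ ∀ c, S 0 = some c → RB b₀ c})
        (by
          rintro e ⟨_, ⟨S, hS, rfl⟩, hne⟩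
          exact h e.succ ⟨S, hS.1, hne⟩)
      simpa only [Set.exists_mem_image, Set.mem_ofPred_eq, and_assoc] using this
    rw [hsumA, hsumB]
    simp only [Fin.prod_univ_succ, Fin.cons_zero, Fin.cons_succ, Fin.forall_fin_succ]
    calc _ = ∑ a' : Fin m → A, (∏ e : Fin m, μ e.succ (a' e)) * ∑ a₀, μ 0 a₀ *
          (if ∃ S ∈ F, (∀ c, S 0 = some c → RA a₀ c) ∧
            ∀ (e : Fin m) c, S e.succ = some c → RA (a' e) c then (1 : ℝ) else 0) := by
          refine sum_congr rfl fun a' _ => ?_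
          rw [mul_sum]
          exact sum_congr rfl fun a₀ _ => by ring
      _ ≤ ∑ a' : Fin m → A, (∏ e : Fin m, μ e.succ (a' e)) * ∑ b₀, ν 0 b₀ *
          (if ∃ S ∈ F, (∀ c, S 0 = some c → RB b₀ c) ∧
            ∀ (e : Fin m) c, S e.succ = some c → RA (a' e) c then (1 : ℝ) else 0) :=
          sum_le_sum fun a' _ => mul_le_mul_of_nonneg_left (first a')
            (prod_nonneg fun e _ => hμ _ _)
      _ = ∑ b₀, ν 0 b₀ * ∑ a' : Fin m → A, (∏ e : Fin m, μ e.succ (a' e)) *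
          (if ∃ S ∈ F, (∀ c, S 0 = some c → RB b₀ c) ∧
            ∀ (e : Fin m) c, S e.succ = some c → RA (a' e) c then (1 : ℝ) else 0) := by
          simp only [mul_sum]
          rw [sum_comm]
          exact sum_congr rfl fun b₀ _ => sum_congr rfl fun a' _ => by ring
      _ ≤ ∑ b₀, ν 0 b₀ * ∑ b' : Fin m → B, (∏ e : Fin m, ν e.succ (b' e)) *
          (if ∃ S ∈ F, (∀ c, S 0 = some c → RB b₀ c) ∧
            ∀ (e : Fin m) c, S e.succ = some c → RB (b' e) c then (1 : ℝ) else 0) :=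
          sum_le_sum fun b₀ _ => mul_le_mul_of_nonneg_left (others b₀) (hν 0 b₀)
      _ = _ := by
          simp only [mul_sum]
          exact sum_congr rfl fun b₀ _ => sum_congr rfl fun a' _ => by ring

open Classical in
/-- If in every coordinate a random element of `B` is at least as likely to hit a given set as a
random element of `A`, then the same is true for the probability to contain a member of a given
family of partial functions. -/
theorem sum_prod_hit_le {E : Type*} [Fintype E] [DecidableEq E] {RA : A → C → Prop} {RB : B → C → Prop}
    {μ : E → A → ℝ} {ν : E → B → ℝ}
    (hμ : ∀ e a, 0 ≤ μ e a) (hν : ∀ e b, 0 ≤ ν e b)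
    (hμ1 : ∀ e, ∑ a, μ e a = 1) (hν1 : ∀ e, ∑ b, ν e b = 1) (F : Set (E → Option C))
    (h : ∀ e, (∃ S ∈ F, S e ≠ none) → ∀ D : Set C,
      ∑ a, μ e a * (if ∃ c ∈ D, RA a c then 1 else 0) ≤
        ∑ b, ν e b * (if ∃ c ∈ D, RB b c then 1 else 0)) :
    ∑ a : E → A, (∏ e, μ e (a e)) *
        (if ∃ S ∈ F, ∀ e c, S e = some c → RA (a e) c then 1 else 0) ≤
      ∑ b : E → B, (∏ e, ν e (b e)) *
        (if ∃ S ∈ F, ∀ e c, S e = some c → RB (b e) c then 1 else 0) := by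
  let φ := Fintype.equivFin E
  have key := sum_prod_hit_le_fin (RA := RA) (RB := RB) (μ := fun i => μ (φ.symm i))
    (ν := fun i => ν (φ.symm i)) (fun _ => hμ _) (fun _ => hν _) (fun _ => hμ1 _) (fun _ => hν1 _)
    ((fun S : E → Option C => S ∘ φ.symm) '' F)
    (by
      rintro i ⟨_, ⟨S, hS, rfl⟩, hne⟩
      exact h _ ⟨S, hS, hne⟩)
  rw [← (φ.symm.arrowCongr (Equiv.refl A)).sum_comp, ← (φ.symm.arrowCongr (Equiv.refl B)).sum_comp]
  simp only [Set.exists_mem_image, Function.comp_apply] at key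
  convert key using 3 with a _ b _
  · rw [← φ.symm.prod_comp]; simp
  · simp only [φ.symm.surjective.forall]; simp
  · rw [← φ.symm.prod_comp]; simp
  · simp only [φ.symm.surjective.forall]; simp

end Coupling

/-! ### Counting permutations that map prescribed edges into H. -/

section Counting

/-- `(1 + 1/N)^v ≤ e < 3` for `v ≤ N`; this is the source of the factors 3. -/
lemma succ_pow_le_three_mul_pow {N v : ℕ} (h : v ≤ N) : ((N : ℝ) + 1) ^ v ≤ 3 * (N : ℝ) ^ v := by
  rcases Nat.eq_zero_or_pos N with rfl | hN
  · simp [Nat.le_zero.mp h]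
  have hN' : (0 : ℝ) < N := by exact_mod_cast hN
  have h1 : (N : ℝ) + 1 = N * (1 + 1 / N) := by field_simp
  rw [h1, mul_pow, mul_comm]
  refine mul_le_mul_of_nonneg_right ?_ (by positivity)
  calc (1 + 1 / (N : ℝ)) ^ v ≤ Real.exp (1 / N) ^ v :=
        pow_le_pow_left₀ (by positivity) (by rw [add_comm]; exact Real.add_one_le_exp _) _
    _ = Real.exp (v / N) := by rw [← Real.exp_nat_mul]; congr 1; ring
    _ ≤ Real.exp 1 := Real.exp_le_exp.mpr (by rw [div_le_one hN']; exact_mod_cast h)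
    _ ≤ 3 := Real.exp_one_lt_three.le

lemma pow_mul_factorial_sub_le {N v : ℕ} (h : v ≤ N) :
    (N : ℝ) ^ v * ((N - v).factorial : ℝ) ≤ 3 ^ v * (N.factorial : ℝ) := by
  induction N generalizing v with
  | zero => simp [Nat.le_zero.mp h]
  | succ N ih =>
    cases v with
    | zero => simp
    | succ v =>
      have hv : v ≤ N := by omega
      rw [Nat.add_sub_add_right, Nat.factorial_succ]
      push_cast
      calc ((N : ℝ) + 1) ^ (v + 1) * ((N - v).factorial : ℝ)
          = (N + 1) * ((N + 1) ^ v * ((N - v).factorial : ℝ)) := by ring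
        _ ≤ (N + 1) * ((3 * (N : ℝ) ^ v) * ((N - v).factorial : ℝ)) := by
            have := succ_pow_le_three_mul_pow hv
            gcongr
        _ = 3 * (N + 1) * ((N : ℝ) ^ v * ((N - v).factorial : ℝ)) := by ring
        _ ≤ 3 * (N + 1) * (3 ^ v * (N.factorial : ℝ)) := by
            exact mul_le_mul_of_nonneg_left (ih hv) (by positivity)
        _ = _ := by ring

open Classical in
/-- The number of permutations with prescribed values. -/
lemma card_perm_prescribed_le {α β : Type*} [Fintype α] [DecidableEq α] (A : Finset β) (u w : β → α)
    (hu : Set.InjOn u A) :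
    (#{σ : Equiv.Perm α | ∀ a ∈ A, σ (u a) = w a} : ℝ) ≤
      (Fintype.card α).factorial * (3 / (Fintype.card α : ℝ)) ^ #A := by
  rcases ({σ : Equiv.Perm α | ∀ a ∈ A, σ (u a) = w a} : Finset _).eq_empty_or_nonempty
    with h | ⟨σ₀, hσ₀⟩
  · rw [h]; simp; positivity
  set N := Fintype.card α with hN
  have hA : #(A.image u) = #A := card_image_of_injOn hu
  have hAN : #A ≤ N := by rw [← hA]; exact card_le_univ _
  -- After composition with `σ₀⁻¹` the permutations fix `u(A)` pointwise.
  have hle : #{σ : Equiv.Perm α | ∀ a ∈ A, σ (u a) = w a} ≤ (N - #A).factorial := by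
    calc _ ≤ Fintype.card {f : Equiv.Perm α // ∀ x, ¬ x ∉ A.image u → f x = x} := by
          rw [Fintype.card_subtype]
          refine card_le_card_of_injOn (fun σ => σ₀⁻¹ * σ) ?_ (fun σ _ σ' _ h => by simpa using h)
          intro σ hσ
          simp only [coe_filter, mem_filter, mem_univ, true_and, Set.mem_ofPred_eq, not_not,
            mem_image] at *
          rintro x ⟨a, ha, rfl⟩
          rw [Equiv.Perm.mul_apply, hσ a ha, Equiv.Perm.inv_eq_iff_eq, hσ₀ a ha]
      _ = (N - #A).factorial := by
          rw [← Fintype.card_congr (Equiv.Perm.subtypeEquivSubtypePerm fun x => x ∉ A.image u),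
            Fintype.card_perm, Fintype.card_subtype_compl, Fintype.card_coe, hA]
  -- For `N = 0` the quotient `3 / N` is 0, but `A` is empty and the power is 1.
  rcases Nat.eq_zero_or_pos N with h0 | hpos
  · have : #A = 0 := by omega
    have hle1 : #{σ : Equiv.Perm α | ∀ a ∈ A, σ (u a) = w a} ≤ 1 := by
      rwa [h0, Nat.zero_sub, Nat.factorial_zero] at hle
    rw [this, h0]
    simpa using hle1
  have hpos' : (0 : ℝ) < N := by exact_mod_cast hpos
  rw [div_pow, mul_div_assoc', le_div_iff₀ (by positivity)]
  have := pow_mul_factorial_sub_le hAN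
  have hle' : (#{σ : Equiv.Perm α | ∀ a ∈ A, σ (u a) = w a} : ℝ) ≤ ((N - #A).factorial : ℝ) := by
    exact_mod_cast hle
  nlinarith [mul_le_mul_of_nonneg_right hle' (pow_nonneg hpos'.le #A)]

variable {n : ℕ}

/-- The partial function which is the restriction of `τ` to `D`. -/
def partialRestrict {α : Type*} [DecidableEq α] (D : Finset α) (τ : α → α) : α → Option α :=
  fun x => if x ∈ D then some (τ x) else none

/-- One more vertex costs the number of choices for its image, which may depend on the images fixed
before. -/
lemma card_image_partialRestrict_insert_le {α : Type*} [DecidableEq α]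
    [DecidableEq (α → Option α)] (P : Finset (α → α))
    (D : Finset α) (x : α) (b : ℕ) (N : (α → Option α) → Finset α) (hN : ∀ h, #(N h) ≤ b)
    (hPN : ∀ τ ∈ P, τ x ∈ N (partialRestrict D τ)) :
    #(P.image (partialRestrict (insert x D))) ≤ b * #(P.image (partialRestrict D)) := by
  have hsub : P.image (partialRestrict (insert x D)) ⊆
      (P.image (partialRestrict D)).biUnion fun h =>
        (N h).image fun y z => if z = x then some y else h z := by
    intro g hg
    obtain ⟨τ, hτ, rfl⟩ := mem_image.mp hg
    refine mem_biUnion.mpr ⟨_, mem_image_of_mem _ hτ, mem_image.mpr ⟨τ x, hPN τ hτ, ?_⟩⟩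
    funext z
    by_cases hz : z = x
    · simp [hz, partialRestrict]
    · simp [hz, partialRestrict]
  calc _ ≤ _ := card_le_card hsub
    _ ≤ _ := card_biUnion_le
    _ ≤ ∑ _h ∈ P.image (partialRestrict D), b :=
        sum_le_sum fun h _ => card_image_le.trans (hN h)
    _ = _ := by rw [sum_const, smul_eq_mul, mul_comm]

open Classical in
/-- The number of restrictions to `V` of homomorphisms between graphs on `Fin n`, the second of
bounded degree. -/
lemma card_image_partialRestrict_le (G H : SimpleGraph (Fin n)) {K : ℕ} (hK : 1 ≤ K)
    (hdeg : ∀ v, #{w | H.Adj v w} ≤ K) (P : Finset (Fin n → Fin n))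
    (hP : ∀ τ ∈ P, ∀ x y, G.Adj x y → H.Adj (τ x) (τ y)) (V : Finset (Fin n))
    (hV : ∀ x y, G.Adj x y → y ∈ V) :
    #(P.image (partialRestrict V)) ≤ K ^ #V * n ^ #(V.image G.connectedComponentMk) := by
  -- A largest `D ⊆ V` satisfying the bound must be `V`: otherwise add a neighbour of `D` (factor
  -- `K`) or a vertex of a new component (factor `n`).
  obtain ⟨D, hD, hmax⟩ := exists_max_image
    (V.powerset.filter fun D => #(P.image (partialRestrict D)) ≤
      K ^ #D * n ^ #(D.image G.connectedComponentMk)) card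
    ⟨∅, by
      simp only [mem_filter, empty_mem_powerset, card_empty, pow_zero, image_empty, mul_one,
        true_and]
      refine card_le_one.mpr ?_
      simp only [mem_image]
      rintro _ ⟨τ, -, rfl⟩ _ ⟨τ', -, rfl⟩
      funext x
      simp [partialRestrict]⟩
  rw [mem_filter, mem_powerset] at hD
  obtain ⟨hDV, hQ⟩ := hD
  suffices h : V ⊆ D by rwa [Subset.antisymm h hDV]
  by_contra hVD
  obtain ⟨x₀, hx₀V, hx₀D⟩ := not_subset.mp hVD
  have hcontra : ∀ x ∈ V, x ∉ D → ¬ #(P.image (partialRestrict (insert x D))) ≤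
      K ^ #(insert x D) * n ^ #((insert x D).image G.connectedComponentMk) := by
    intro x hxV hxD h
    have := hmax (insert x D) (by
      rw [mem_filter, mem_powerset]
      exact ⟨insert_subset hxV hDV, h⟩)
    rw [card_insert_of_notMem hxD] at this
    omega
  by_cases hadj : ∃ x ∈ V, x ∉ D ∧ ∃ y ∈ D, G.Adj y x
  · obtain ⟨x, hxV, hxD, y, hyD, hyx⟩ := hadj
    refine hcontra x hxV hxD ?_
    have hcomp : (insert x D).image G.connectedComponentMk = D.image G.connectedComponentMk := by
      rw [image_insert, insert_eq_self, mem_image]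
      exact ⟨y, hyD, SimpleGraph.ConnectedComponent.sound hyx.reachable⟩
    rw [hcomp, card_insert_of_notMem hxD, pow_succ]
    calc _ ≤ K * #(P.image (partialRestrict D)) := by
          refine card_image_partialRestrict_insert_le P D x K
            (fun h => match h y with
              | some z => {w | H.Adj z w}
              | none => ∅) (fun h => ?_) (fun τ hτ => ?_)
          · split
            · exact hdeg _
            · simp
          · simp [partialRestrict, hyD, hP τ hτ y x hyx]
      _ ≤ K * (K ^ #D * n ^ #(D.image G.connectedComponentMk)) := Nat.mul_le_mul_left _ hQ
      _ = _ := by ring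
  · push Not at hadj
    -- A walk from `D` to `x₀` would have an edge leaving `D`, so `x₀` lies in a component that `D`
    -- misses.
    by_cases hcl : G.connectedComponentMk x₀ ∈ D.image G.connectedComponentMk
    · obtain ⟨y, hyD, hy⟩ := mem_image.mp hcl
      obtain ⟨walk⟩ := SimpleGraph.ConnectedComponent.exact hy
      obtain ⟨a, -, ha1, ha2⟩ := walk.exists_boundary_dart (D : Set (Fin n)) hyD (by simpa using hx₀D)
      exact hadj _ (hV _ _ a.adj) (by simpa using ha2) _ (by simpa using ha1) a.adj
    refine hcontra x₀ hx₀V hx₀D ?_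
    rw [image_insert, card_insert_of_notMem hcl, card_insert_of_notMem hx₀D]
    calc _ ≤ n * #(P.image (partialRestrict D)) :=
          card_image_partialRestrict_insert_le P D x₀ n (fun _ => univ) (by simp) (by simp)
      _ ≤ n * (K ^ #D * n ^ #(D.image G.connectedComponentMk)) := Nat.mul_le_mul_left _ hQ
      _ ≤ K * (n * (K ^ #D * n ^ #(D.image G.connectedComponentMk))) := Nat.le_mul_of_pos_left _ hK
      _ = _ := by ring

open Classical in
/-- In a subset `S` of the edges of a graph whose density is at most `d`, the number of edges is at
most `(d + 1) / 2` times the rank. -/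
lemma two_mul_card_le_mul_rank (S : Finset (Sym2 (Fin n))) {d : ℕ} (hS : ∀ e ∈ S, ¬ e.IsDiag)
    (hd : ∀ U : Finset (Fin n), 2 * #{e ∈ S | ∀ x ∈ e, x ∈ U} ≤ d * #U) :
    2 * #S ≤ (d + 1) * (#{x | ∃ e ∈ S, x ∈ e} -
      #(({x | ∃ e ∈ S, x ∈ e} : Finset (Fin n)).image
        (SimpleGraph.fromEdgeSet (S : Set (Sym2 (Fin n)))).connectedComponentMk)) := by
  set G := SimpleGraph.fromEdgeSet (S : Set (Sym2 (Fin n))) with hG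
  set V : Finset (Fin n) := {x | ∃ e ∈ S, x ∈ e} with hV
  set comp := G.connectedComponentMk with hcomp
  have hpair : ∀ U : Finset (Fin n), 2 * #{e ∈ S | ∀ x ∈ e, x ∈ U} ≤ #U * (#U - 1) := by
    intro U
    have : ({e ∈ S | ∀ x ∈ e, x ∈ U} : Finset _) ⊆ U.offDiag.image Sym2.mk.uncurry := by
      intro e he
      rw [mem_filter] at he
      induction e with | h x y =>
      have := hS _ he.1
      rw [Sym2.mk_isDiag_iff] at this
      exact mem_image.mpr ⟨(x, y), by simp [he.2 x (by simp), he.2 y (by simp), this], rfl⟩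
    have h2 := card_le_card this
    rw [Sym2.card_image_offDiag, Nat.choose_two_right] at h2
    have := Nat.div_mul_le_self (#U * (#U - 1)) 2
    omega
  -- The pair count suffices when `#U ≤ d`; beyond that, `d * #U ≤ (d + 1) * (#U - 1)`.
  have hcomb : ∀ U : Finset (Fin n), 2 * #{e ∈ S | ∀ x ∈ e, x ∈ U} ≤ (d + 1) * (#U - 1) := by
    intro U
    rcases Nat.lt_or_ge #U (d + 1) with h | h
    · exact (hpair U).trans (Nat.mul_le_mul_right _ h.le)
    · refine (hd U).trans ?_
      obtain ⟨t, ht⟩ := Nat.exists_eq_add_of_le h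
      rw [ht, show d + 1 + t - 1 = d + t by omega]
      nlinarith
  have hfib : ∀ e ∈ S, comp e.out.1 ∈ V.image comp := fun e he =>
    mem_image_of_mem _ (by rw [hV, mem_filter]; exact ⟨mem_univ _, e, he, Sym2.out_fst_mem e⟩)
  have hsub : ∀ κ, ({e ∈ S | comp e.out.1 = κ} : Finset _) ⊆
      {e ∈ S | ∀ x ∈ e, x ∈ ({x ∈ V | comp x = κ} : Finset _)} := by
    intro κ e he
    rw [mem_filter] at he ⊢
    refine ⟨he.1, fun x hx => ?_⟩
    rw [mem_filter]
    refine ⟨by rw [hV, mem_filter]; exact ⟨mem_univ _, e, he.1, hx⟩, ?_⟩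
    rw [← he.2]
    by_cases hxe : x = e.out.1
    · rw [hxe]
    · refine SimpleGraph.ConnectedComponent.sound (SimpleGraph.Adj.reachable ?_)
      rw [hG, SimpleGraph.fromEdgeSet_adj]
      refine ⟨?_, hxe⟩
      have : e = s(x, e.out.1) := (Sym2.mem_and_mem_iff hxe).mp ⟨hx, Sym2.out_fst_mem e⟩
      rw [← this]
      exact he.1
  have hone : ∀ κ ∈ V.image comp, 1 ≤ #{x ∈ V | comp x = κ} := by
    intro κ hκ
    obtain ⟨x, hx, rfl⟩ := mem_image.mp hκ
    exact card_pos.mpr ⟨x, by simp [hx]⟩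
  calc 2 * #S = ∑ κ ∈ V.image comp, 2 * #{e ∈ S | comp e.out.1 = κ} := by
        rw [← mul_sum, card_eq_sum_card_fiberwise (t := V.image comp) hfib]
    _ ≤ ∑ κ ∈ V.image comp, (d + 1) * (#{x ∈ V | comp x = κ} - 1) := by
        refine sum_le_sum fun κ _ => ?_
        exact (Nat.mul_le_mul_left _ (card_le_card (hsub κ))).trans (hcomb _)
    _ = (d + 1) * (#V - #(V.image comp)) := by
        rw [← mul_sum]
        congr 1
        rw [card_eq_sum_card_image comp V, card_eq_sum_ones (V.image comp),
          ← sum_tsub_distrib _ hone]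

open Classical in
/-- The number of permutations which map a given set of pairs into the edges of a sparse graph of
bounded degree. -/
theorem card_perm_map_edges_le (hn : 0 < n) (H : SimpleGraph (Fin n)) {K d : ℕ} (hK : 1 ≤ K)
    (hdeg : ∀ v, #{w | H.Adj v w} ≤ K)
    (hd : ∀ U : Finset (Fin n), 2 * #{e ∈ H.edgeFinset | ∀ x ∈ e, x ∈ U} ≤ d * #U)
    (S : Finset (Sym2 (Fin n))) :
    (#{τ : Equiv.Perm (Fin n) | ∀ e ∈ S, e.map τ ∈ H.edgeSet} : ℝ) ≤
      n.factorial * (9 * K ^ 2 * (n : ℝ) ^ (-(2 / ((d : ℝ) + 1)))) ^ #S := by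
  set P : Finset (Equiv.Perm (Fin n)) := {τ | ∀ e ∈ S, e.map τ ∈ H.edgeSet} with hP
  have hn' : (1 : ℝ) ≤ n := by exact_mod_cast hn
  have hn0 : (0 : ℝ) < n := by linarith
  have hK' : (1 : ℝ) ≤ K := by exact_mod_cast hK
  rcases P.eq_empty_or_nonempty with h | ⟨τ₀, hτ₀⟩
  · rw [h]; simp only [card_empty, Nat.cast_zero]; positivity
  have hPmem : ∀ τ ∈ P, ∀ e ∈ S, e.map τ ∈ H.edgeSet := fun τ hτ => by simpa [hP] using hτ
  have hS : ∀ e ∈ S, ¬ e.IsDiag := by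
    intro e he hdiag
    refine H.not_isDiag_of_mem_edgeSet (hPmem τ₀ hτ₀ e he) ?_
    rwa [Sym2.isDiag_map τ₀.injective]
  -- `τ₀` embeds `S` into H, so `S` inherits its sparsity.
  have hdS : ∀ U : Finset (Fin n), 2 * #{e ∈ S | ∀ x ∈ e, x ∈ U} ≤ d * #U := by
    intro U
    have h1 := hd (U.image τ₀)
    rw [card_image_of_injective _ τ₀.injective] at h1
    refine le_trans (Nat.mul_le_mul_left _ ?_) h1
    refine card_le_card_of_injOn (Sym2.map τ₀) (fun e he => ?_)
      (Sym2.map.injective τ₀.injective).injOn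
    simp only [coe_filter, Set.mem_ofPred_eq, SimpleGraph.mem_edgeFinset] at he ⊢
    refine ⟨hPmem τ₀ hτ₀ e he.1, fun x hx => ?_⟩
    obtain ⟨y, hy, rfl⟩ := Sym2.mem_map.mp hx
    exact mem_image_of_mem _ (he.2 y hy)
  have hrank := two_mul_card_le_mul_rank S hS hdS
  set G := SimpleGraph.fromEdgeSet (S : Set (Sym2 (Fin n))) with hG
  set V : Finset (Fin n) := {x | ∃ e ∈ S, x ∈ e} with hV
  set m := #(V.image G.connectedComponentMk) with hm
  have hmV : m ≤ #V := card_image_le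
  have hVS : #V ≤ 2 * #S := by
    calc #V ≤ #(S.biUnion fun e => e.toFinset) := by
          refine card_le_card fun x hx => ?_
          rw [hV, mem_filter] at hx
          obtain ⟨-, e, he, hxe⟩ := hx
          exact mem_biUnion.mpr ⟨e, he, by simpa using hxe⟩
      _ ≤ ∑ e ∈ S, #e.toFinset := card_biUnion_le
      _ ≤ ∑ _e ∈ S, 2 := sum_le_sum fun e he => by
          rw [Sym2.card_toFinset_of_not_isDiag _ (hS e he)]
      _ = 2 * #S := by rw [sum_const, smul_eq_mul, mul_comm]
  have himage := card_image_partialRestrict_le G H hK hdeg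
    (P.image fun τ : Equiv.Perm (Fin n) => (τ : Fin n → Fin n))
    (by
      intro τ' hτ' x y hxy
      obtain ⟨τ, hτ, rfl⟩ := mem_image.mp hτ'
      rw [hG, SimpleGraph.fromEdgeSet_adj] at hxy
      simpa using hPmem τ hτ _ hxy.1)
    V (by
      intro x y hxy
      rw [hG, SimpleGraph.fromEdgeSet_adj] at hxy
      rw [hV, mem_filter]
      exact ⟨mem_univ _, s(x, y), hxy.1, by simp⟩)
  rw [image_image] at himage
  set ρ : Equiv.Perm (Fin n) → Fin n → Option (Fin n) :=
    partialRestrict V ∘ fun τ : Equiv.Perm (Fin n) => (τ : Fin n → Fin n) with hρ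
  have hfibre : ∀ h ∈ P.image ρ, (#{τ ∈ P | ρ τ = h} : ℝ) ≤ n.factorial * (3 / (n : ℝ)) ^ #V := by
    intro h hh
    obtain ⟨τ₁, -, rfl⟩ := mem_image.mp hh
    have : (#{σ : Equiv.Perm (Fin n) | ∀ x ∈ V, σ x = τ₁ x} : ℝ) ≤
        n.factorial * (3 / (n : ℝ)) ^ #V := by
      convert card_perm_prescribed_le V id τ₁ (Set.injOn_id _) <;> simp
    refine le_trans ?_ this
    refine Nat.cast_le.mpr (card_le_card fun τ hτ => ?_)
    rw [mem_filter] at hτ ⊢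
    refine ⟨mem_univ _, fun x hx => ?_⟩
    simpa [hρ, partialRestrict, hx] using congrFun hτ.2 x
  have hcount : (#P : ℝ) ≤ (K ^ #V * n ^ m : ℕ) * (n.factorial * (3 / (n : ℝ)) ^ #V) := by
    calc (#P : ℝ) = ∑ h ∈ P.image ρ, (#{τ ∈ P | ρ τ = h} : ℝ) := by
          exact_mod_cast card_eq_sum_card_image ρ P
      _ ≤ ∑ _h ∈ P.image ρ, n.factorial * (3 / (n : ℝ)) ^ #V := sum_le_sum hfibre
      _ = #(P.image ρ) * (n.factorial * (3 / (n : ℝ)) ^ #V) := by rw [sum_const, nsmul_eq_mul]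
      _ ≤ _ := by
          refine mul_le_mul_of_nonneg_right ?_ (by positivity)
          exact_mod_cast himage
  -- `t` is the rank of `S`: what remains of `n ^ m / n ^ #V` is `n ^ (-t)`.
  obtain ⟨t, ht⟩ := Nat.exists_eq_add_of_le hmV
  have hst : (2 * #S : ℝ) ≤ (d + 1) * t := by
    rw [ht, Nat.add_sub_cancel_left] at hrank
    exact_mod_cast hrank
  have hpow : ((n : ℝ) ^ t)⁻¹ ≤ ((n : ℝ) ^ (-(2 / ((d : ℝ) + 1)))) ^ #S := by
    rw [← Real.rpow_natCast, ← Real.rpow_neg hn0.le, ← Real.rpow_mul_natCast hn0.le]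
    refine Real.rpow_le_rpow_of_exponent_le hn' ?_
    rw [neg_mul, neg_le_neg_iff, div_mul_eq_mul_div, div_le_iff₀ (by positivity)]
    linarith
  calc (#P : ℝ) ≤ (K ^ #V * n ^ m : ℕ) * (n.factorial * (3 / (n : ℝ)) ^ #V) := hcount
    _ = n.factorial * ((3 * K) ^ #V * ((n : ℝ) ^ t)⁻¹) := by
        push_cast
        rw [div_pow, mul_pow]
        nth_rewrite 3 [ht]
        rw [pow_add (n : ℝ)]
        field_simp
    _ ≤ n.factorial * ((3 * K) ^ (2 * #S) * ((n : ℝ) ^ (-(2 / ((d : ℝ) + 1)))) ^ #S) := by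
        have : (3 * K : ℝ) ^ #V ≤ (3 * K) ^ (2 * #S) :=
          pow_le_pow_right₀ (by linarith) hVS
        gcongr
    _ = _ := by
        rw [pow_mul, ← mul_pow]
        ring

end Counting

/-! ### Spreadness of the coloured copies. -/

section ColouredCopies

variable {n c : ℕ}

/-- The coloured edges of the copy of `H` under the permutation `x.1` of the vertices, in which the
edge that comes from `e` has the colour `x.2 (j e)`. -/
noncomputable def colouredCopy (H : SimpleGraph (Fin n)) [DecidableRel H.Adj]
    (j : Sym2 (Fin n) → Fin c) (x : Equiv.Perm (Fin n) × Equiv.Perm (Fin c)) :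
    Finset (Sym2 (Fin n) × Fin c) :=
  H.edgeFinset.image fun e => (e.map x.1, x.2 (j e))

lemma mem_colouredCopy {H : SimpleGraph (Fin n)} [DecidableRel H.Adj] {j : Sym2 (Fin n) → Fin c}
    {x : Equiv.Perm (Fin n) × Equiv.Perm (Fin c)} {a : Sym2 (Fin n) × Fin c} :
    a ∈ colouredCopy H j x ↔
      a.1.map ⇑(x.1⁻¹) ∈ H.edgeSet ∧ x.2 (j (a.1.map ⇑(x.1⁻¹))) = a.2 := by
  have h1 : ∀ e : Sym2 (Fin n), (e.map x.1).map ⇑(x.1⁻¹) = e := fun e => by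
    rw [Sym2.map_map, show ⇑(x.1⁻¹) ∘ ⇑x.1 = id by funext y; simp, Sym2.map_id, id]
  have h2 : ∀ e : Sym2 (Fin n), (e.map ⇑(x.1⁻¹)).map x.1 = e := fun e => by
    rw [Sym2.map_map, show ⇑x.1 ∘ ⇑(x.1⁻¹) = id by funext y; simp, Sym2.map_id, id]
  simp only [colouredCopy, mem_image, SimpleGraph.mem_edgeFinset]
  constructor
  · rintro ⟨e, he, rfl⟩
    simpa only [h1, and_true] using he
  · rintro ⟨he, hc⟩
    exact ⟨_, he, Prod.ext (h2 a.1) hc⟩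

open Classical in
/-- The coloured copies of a sparse graph of bounded degree form a spread family. -/
theorem card_colouredCopy_superset_le (hn : 0 < n) (H : SimpleGraph (Fin n)) {K d : ℕ} (hK : 1 ≤ K)
    (hdeg : ∀ v, #{w | H.Adj v w} ≤ K)
    (hd : ∀ U : Finset (Fin n), 2 * #{e ∈ H.edgeFinset | ∀ x ∈ e, x ∈ U} ≤ d * #U)
    {j : Sym2 (Fin n) → Fin c} (hj : Set.InjOn j H.edgeSet) (A : Finset (Sym2 (Fin n) × Fin c)) :
    (#{x : Equiv.Perm (Fin n) × Equiv.Perm (Fin c) | A ⊆ colouredCopy H j x} : ℝ) ≤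
      (9 * K ^ 2 * (n : ℝ) ^ (-(2 / ((d : ℝ) + 1))) * (3 / c)) ^ #A *
        (Fintype.card (Equiv.Perm (Fin n) × Equiv.Perm (Fin c)) : ℝ) := by
  set Q : Finset (Equiv.Perm (Fin n) × Equiv.Perm (Fin c)) := {x | A ⊆ colouredCopy H j x} with hQ
  have hQmem : ∀ x ∈ Q, ∀ a ∈ A, a.1.map ⇑(x.1⁻¹) ∈ H.edgeSet ∧
      x.2 (j (a.1.map ⇑(x.1⁻¹))) = a.2 := fun x hx a ha =>
    mem_colouredCopy.mp ((mem_filter.mp hx).2 ha)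
  rcases Q.eq_empty_or_nonempty with h | ⟨x₀, hx₀⟩
  · rw [h]; simp only [card_empty, Nat.cast_zero]; positivity
  -- A copy gives each of its pairs one colour, so a set `A` inside a copy cannot repeat a pair.
  have hinj : Set.InjOn Prod.fst (A : Set (Sym2 (Fin n) × Fin c)) := by
    intro a ha b hb hab
    refine Prod.ext hab ?_
    rw [← (hQmem x₀ hx₀ a ha).2, ← (hQmem x₀ hx₀ b hb).2, hab]
  set S := A.image Prod.fst with hS
  have hSA : #S = #A := card_image_of_injOn hinj
  set P : Finset (Equiv.Perm (Fin n)) := {τ | ∀ e ∈ S, e.map τ ∈ H.edgeSet} with hP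
  have hPcard : (#P : ℝ) ≤
      n.factorial * (9 * K ^ 2 * (n : ℝ) ^ (-(2 / ((d : ℝ) + 1)))) ^ #A := by
    rw [← hSA]
    convert card_perm_map_edges_le hn H hK hdeg hd S
  have hQP : ∀ x ∈ Q, x.1⁻¹ ∈ P := by
    intro x hx
    rw [hP, mem_filter]
    refine ⟨mem_univ _, fun e he => ?_⟩
    obtain ⟨a, ha, rfl⟩ := mem_image.mp he
    exact (hQmem x hx a ha).1
  have hfibre : ∀ τ ∈ P, (#{x ∈ Q | x.1⁻¹ = τ} : ℝ) ≤ c.factorial * (3 / (c : ℝ)) ^ #A := by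
    intro τ hτ
    rw [hP, mem_filter] at hτ
    have hu : Set.InjOn (fun a : Sym2 (Fin n) × Fin c => j (a.1.map τ)) A := by
      intro a ha b hb hab
      refine hinj ha hb (Sym2.map.injective τ.injective (hj ?_ ?_ hab))
      · exact hτ.2 _ (mem_image_of_mem _ ha)
      · exact hτ.2 _ (mem_image_of_mem _ hb)
    have := card_perm_prescribed_le A _ Prod.snd hu
    rw [Fintype.card_fin] at this
    refine le_trans (Nat.cast_le.mpr ?_) this
    refine card_le_card_of_injOn Prod.snd (fun x hx => ?_) (fun x hx y hy hxy => ?_)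
    · simp only [coe_filter, Set.mem_ofPred_eq, mem_univ, true_and] at hx ⊢
      intro a ha
      have := (hQmem x hx.1 a ha).2
      rwa [hx.2] at this
    · simp only [coe_filter, Set.mem_ofPred_eq] at hx hy
      exact Prod.ext (inv_injective (hx.2.trans hy.2.symm)) hxy
  calc (#Q : ℝ) = ∑ τ ∈ P, (#{x ∈ Q | x.1⁻¹ = τ} : ℝ) := by
        exact_mod_cast card_eq_sum_card_fiberwise hQP
    _ ≤ ∑ _τ ∈ P, c.factorial * (3 / (c : ℝ)) ^ #A := sum_le_sum hfibre
    _ = #P * (c.factorial * (3 / (c : ℝ)) ^ #A) := by rw [sum_const, nsmul_eq_mul]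
    _ ≤ n.factorial * (9 * K ^ 2 * (n : ℝ) ^ (-(2 / ((d : ℝ) + 1)))) ^ #A *
        (c.factorial * (3 / (c : ℝ)) ^ #A) :=
        mul_le_mul_of_nonneg_right hPcard (by positivity)
    _ = _ := by
        rw [Fintype.card_prod, Fintype.card_perm, Fintype.card_perm, Fintype.card_fin,
          Fintype.card_fin, mul_pow _ (3 / (c : ℝ))]
        push_cast
        ring

end ColouredCopies

/-! ### From random (pair, colour) sets to states of pairs. -/

section Coordinates

lemma sum_subsetWeight_mem {X : Type*} [Fintype X] [DecidableEq X] (p : ℝ) (x : X) :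
    ∑ W : Finset X, subsetWeight p W * (if x ∈ W then 1 else 0) = p := by
  have h := Finset.prod_add (fun _ : X => p) (fun y => if y = x then 0 else 1 - p) univ
  rw [powerset_univ] at h
  calc ∑ W : Finset X, subsetWeight p W * (if x ∈ W then 1 else 0)
      = ∏ y : X, (p + if y = x then 0 else 1 - p) := by
        rw [h]
        refine sum_congr rfl fun W _ => ?_
        by_cases hx : x ∈ W
        · rw [subsetWeight, prod_ite, if_pos hx, mul_one]
          congr 1
          · simp
          · refine prod_congr (by ext; simp) fun y hy => ?_
            rw [mem_sdiff] at hy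
            rw [if_neg (by rintro rfl; exact hy.2 hx)]
        · rw [if_neg hx, mul_zero, prod_eq_zero (s := univ \ W) (i := x) (by simp [hx]) (by simp),
            mul_zero]
    _ = ∏ y : X, if y = x then p else 1 := prod_congr rfl fun y _ => by split_ifs <;> ring
    _ = p := by simp

lemma sum_prod_subsetWeight_mem {X : Type*} [Fintype X] [DecidableEq X] (p : ℝ) (x : X) {r : ℕ}
    (l : Fin r) :
    ∑ Ws : Fin r → Finset X, (∏ i, subsetWeight p (Ws i)) * (if x ∈ Ws l then 1 else 0) = p := by
  calc _ = ∑ Ws : Fin r → Finset X, ∏ i, (subsetWeight p (Ws i) *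
        if i = l then (if x ∈ Ws i then 1 else 0) else 1) := by
        refine sum_congr rfl fun Ws _ => ?_
        rw [prod_mul_distrib]
        simp
    _ = ∏ i : Fin r, ∑ W : Finset X, (subsetWeight p W *
        if i = l then (if x ∈ W then 1 else 0) else 1) := by
        rw [Finset.prod_univ_sum, Fintype.piFinset_univ]
    _ = ∏ i : Fin r, if i = l then p else 1 := by
        refine prod_congr rfl fun i _ => ?_
        by_cases h : i = l
        · simp only [h, if_true, sum_subsetWeight_mem]
        · simp [h, sum_subsetWeight]
    _ = p := by simp

open Classical in
/-- The union bound for hitting a set in `r` rounds. -/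
lemma sum_rounds_hit_le {X : Type*} [Fintype X] {p : ℝ} (hp0 : 0 ≤ p) (hp1 : p ≤ 1)
    (r : ℕ) (D : Set X) :
    ∑ Ws : Fin r → Finset X, (∏ i, subsetWeight p (Ws i)) *
      (if ∃ x ∈ D, ∃ l, x ∈ Ws l then 1 else 0) ≤ #{x | x ∈ D} * (r * p) := by
  calc _ ≤ ∑ Ws : Fin r → Finset X, ∑ x with x ∈ D, ∑ l : Fin r,
        (∏ i, subsetWeight p (Ws i)) * (if x ∈ Ws l then 1 else 0) := by
        refine sum_le_sum fun Ws _ => ?_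
        have h0 : 0 ≤ ∏ i, subsetWeight p (Ws i) :=
          prod_nonneg fun i _ => subsetWeight_nonneg hp0 hp1 _
        simp only [← mul_sum]
        refine mul_le_mul_of_nonneg_left ?_ h0
        have hnn : ∀ x ∈ ({x | x ∈ D} : Finset X),
            (0 : ℝ) ≤ ∑ l : Fin r, if x ∈ Ws l then 1 else 0 :=
          fun x _ => sum_nonneg fun l _ => by split_ifs <;> norm_num
        by_cases h : ∃ x ∈ D, ∃ l, x ∈ Ws l
        · obtain ⟨x, hx, l, hl⟩ := h
          rw [if_pos ⟨x, hx, l, hl⟩]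
          refine le_trans ?_ (single_le_sum hnn (by simpa using hx))
          refine le_trans ?_ (single_le_sum (fun l _ => by split_ifs <;> norm_num) (mem_univ l))
          simp [hl]
        · rw [if_neg h]
          exact sum_nonneg hnn
    _ = ∑ x with x ∈ D, ∑ l : Fin r, p := by
        rw [sum_comm]
        refine sum_congr rfl fun x _ => ?_
        rw [sum_comm]
        exact sum_congr rfl fun l _ => sum_prod_subsetWeight_mem p x l
    _ = _ := by simp

/-- The law of the state of a pair in the coloured binomial random graph: whether it is an edge, and
its colour. -/
noncomputable def pairWeight {n : ℕ} (p : ℝ) (c : ℕ) (e : Sym2 (Fin n)) (b : Bool × Fin c) : ℝ :=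
  (if e.IsDiag then (if b.1 then 0 else 1) else (if b.1 then p else 1 - p)) * (1 / c)

lemma pairWeight_nonneg {n c : ℕ} {p : ℝ} (hp0 : 0 ≤ p) (hp1 : p ≤ 1) (e : Sym2 (Fin n))
    (b : Bool × Fin c) : 0 ≤ pairWeight p c e b := by
  refine mul_nonneg ?_ (by positivity)
  split_ifs <;> linarith

lemma sum_pairWeight {n c : ℕ} (hc : 0 < c) (p : ℝ) (e : Sym2 (Fin n)) :
    ∑ b : Bool × Fin c, pairWeight p c e b = 1 := by
  have hc' : (c : ℝ) ≠ 0 := by exact_mod_cast hc.ne'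
  rw [Fintype.sum_prod_type]
  by_cases he : e.IsDiag
  · simp [pairWeight, he, hc']
  · simp [pairWeight, he]
    field_simp
    ring

-- Different colours exclude each other, so this is an equality. It meets the union bound
-- `sum_rounds_hit_le` when the rounds have density `p / (r c)`.
open Classical in
lemma sum_pairWeight_hit {n c : ℕ} (p : ℝ) {e : Sym2 (Fin n)} (he : ¬ e.IsDiag) (D : Set (Fin c)) :
    ∑ b : Bool × Fin c, pairWeight p c e b * (if ∃ x ∈ D, b.1 = true ∧ b.2 = x then 1 else 0) =
      #{x | x ∈ D} * (p / c) := by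
  have h : ∀ y : Fin c, (∃ x ∈ D, y = x) ↔ y ∈ D := fun y => by simp
  rw [Fintype.sum_prod_type, Fintype.sum_bool]
  simp only [pairWeight, he, if_false, if_true, true_and, Bool.false_eq_true, false_and, and_false,
    exists_false, mul_zero, sum_const_zero, add_zero, h, mul_ite, mul_one, ← sum_filter, sum_const,
    nsmul_eq_mul]
  rw [mul_one_div]

open Classical in
/-- In the product of the laws of the states of the pairs, a coloured copy of a sparse graph of
bounded degree appears with high probability. -/
theorem one_sub_le_sum_pairWeight {n c : ℕ} (hn : 0 < n) (hc : 0 < c) (H : SimpleGraph (Fin n))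
    {K d : ℕ} (hK : 1 ≤ K) (hdeg : ∀ v, #{w | H.Adj v w} ≤ K)
    (hd : ∀ U : Finset (Fin n), 2 * #{e ∈ H.edgeFinset | ∀ x ∈ e, x ∈ U} ≤ d * #U)
    {j : Sym2 (Fin n) → Fin c} (hj : Set.InjOn j H.edgeSet) {p m : ℝ} (hp0 : 0 < p) (hp1 : p ≤ 1)
    (hm : 1 ≤ m) {r : ℕ} (hr : 0 < r) (hHr : #H.edgeFinset < 2 ^ r)
    (hpm : 108 * m ^ 2 * K ^ 2 * r * (n : ℝ) ^ (-(2 / ((d : ℝ) + 1))) ≤ p) :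
    1 - r / m ≤ ∑ b : Sym2 (Fin n) → Bool × Fin c, (∏ e, pairWeight p c e (b e)) *
      (if ∃ x, ∀ a ∈ colouredCopy H j x, (b a.1).1 = true ∧ (b a.1).2 = a.2 then 1 else 0) := by
  have hr' : (1 : ℝ) ≤ r := by exact_mod_cast hr
  have hc' : (1 : ℝ) ≤ c := by exact_mod_cast hc
  have hm0 : 0 < m := by linarith
  -- Chosen so that `r * π = p / c`. The condition `4 m² q ≤ π` then reads as `hpm`, with `108 = 4 ·
  -- 9 · 3`.
  set π : ℝ := p / (r * c) with hπ
  have hrc : (1 : ℝ) ≤ r * c := one_le_mul_of_one_le_of_one_le hr' hc'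
  have hrc0 : (0 : ℝ) < r * c := by linarith
  have hπ0 : 0 < π := div_pos hp0 hrc0
  have hπ1 : π ≤ 1 := by rw [hπ, div_le_one hrc0]; linarith
  have hspread := card_mul_fail_le (X := Sym2 (Fin n) × Fin c) hπ0 hπ1 hm
    (q := 9 * K ^ 2 * (n : ℝ) ^ (-(2 / ((d : ℝ) + 1))) * (3 / c))
    (M := Fintype.card (Equiv.Perm (Fin n) × Equiv.Perm (Fin c))) (by positivity)
    (by
      rw [hπ, le_div_iff₀ hrc0]
      refine le_trans (le_of_eq ?_) hpm
      field_simp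
      ring) r univ (colouredCopy H j) hHr (fun x _ => card_image_le)
    (fun A => by convert card_colouredCopy_superset_le hn H hK hdeg hd hj A)
  have hcard : (0 : ℝ) < Fintype.card (Equiv.Perm (Fin n) × Equiv.Perm (Fin c)) := by
    exact_mod_cast Fintype.card_pos
  rw [card_univ, mul_div_left_comm, mul_le_mul_iff_right₀ hcard] at hspread
  -- The copies as partial functions from pairs to colours, the form the coupling needs.
  set F : Set (Sym2 (Fin n) → Option (Fin c)) := Set.range fun x e =>
    if ∃ y, (e, y) ∈ colouredCopy H j x then some (x.2 (j (e.map ⇑(x.1⁻¹)))) else none with hF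
  have hFiff : ∀ R : Sym2 (Fin n) → Fin c → Prop,
      (∃ S ∈ F, ∀ e y, S e = some y → R e y) ↔ ∃ x, ∀ a ∈ colouredCopy H j x, R a.1 a.2 := by
    intro R
    rw [hF, Set.exists_range_iff]
    refine exists_congr fun x => ⟨fun h a ha => ?_, fun h e y hy => ?_⟩
    · exact h a.1 a.2 ((if_pos ⟨a.2, ha⟩).trans (by rw [(mem_colouredCopy.mp ha).2]))
    · dsimp only at hy
      split_ifs at hy with h1
      obtain ⟨z, hz⟩ := h1
      have := (mem_colouredCopy.mp hz).2
      rw [Option.some_inj] at hy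
      simp only at this
      rw [hy] at this
      exact h (e, y) (this ▸ hz)
  have hcoupling := sum_prod_hit_le (E := Sym2 (Fin n)) (A := Fin r → Finset (Fin c))
    (B := Bool × Fin c) (RA := fun a y => ∃ l, y ∈ a l) (RB := fun b y => b.1 = true ∧ b.2 = y)
    (μ := fun _ a => ∏ l, subsetWeight π (a l)) (ν := fun e b => pairWeight p c e b)
    (fun _ a => prod_nonneg fun l _ => subsetWeight_nonneg hπ0.le hπ1 _)
    (fun e b => pairWeight_nonneg hp0.le hp1 e b) (fun _ => sum_prod_subsetWeight π r)
    (fun e => sum_pairWeight hc p e) F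
    (by
      rintro e ⟨_, ⟨x, rfl⟩, hne⟩ D
      have he : ¬ e.IsDiag := by
        intro hdiag
        obtain ⟨y, hy⟩ : ∃ y, (e, y) ∈ colouredCopy H j x := by
          by_contra h
          simp [h] at hne
        refine H.not_isDiag_of_mem_edgeSet (mem_colouredCopy.mp hy).1 ?_
        rwa [Sym2.isDiag_map (x.1⁻¹).injective]
      have hD : (#{y | y ∈ D} : ℝ) * (r * π) = #{y | y ∈ D} * (p / c) := by
        rw [hπ]
        field_simp
      convert (sum_rounds_hit_le hπ0.le hπ1 r D).trans_eq (hD.trans (sum_pairWeight_hit p he D).symm))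
  simp only [hFiff] at hcoupling
  refine le_trans ?_ hcoupling
  -- Regroups the `r` random sets by pair, which makes the pairs independent coordinates.
  let φ : (Sym2 (Fin n) → Fin r → Finset (Fin c)) ≃ (Fin r → Finset (Sym2 (Fin n) × Fin c)) :=
    { toFun := fun a l => {x | x.2 ∈ a x.1 l}
      invFun := fun Ws e l => {y | (e, y) ∈ Ws l}
      left_inv := fun a => by ext; simp
      right_inv := fun Ws => by ext; simp }
  rw [← φ.sum_comp] at hspread
  have hweight : ∀ a, ∏ l, subsetWeight π (φ a l) = ∏ e, ∏ l, subsetWeight π (a e l) := by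
    intro a
    rw [prod_comm]
    refine prod_congr rfl fun l _ => ?_
    simp only [subsetWeight, Fintype.prod_prod_type]
    refine prod_congr rfl fun e _ => prod_congr rfl fun y _ => ?_
    simp [φ]
  have hevent : ∀ a, (∃ i ∈ (univ : Finset (Equiv.Perm (Fin n) × Equiv.Perm (Fin c))),
      colouredCopy H j i ⊆ univ.biUnion (φ a)) ↔
      ∃ x, ∀ b ∈ colouredCopy H j x, ∃ l, b.2 ∈ a b.1 l := by
    intro a
    simp [φ, Finset.subset_iff]
  simp only [hweight, hevent] at hspread
  have hone : ∑ a : Sym2 (Fin n) → Fin r → Finset (Fin c),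
      ∏ e, ∏ l, subsetWeight π (a e l) = 1 := by
    simp only [← hweight]
    rw [φ.sum_comp fun Ws => ∏ l, subsetWeight π (Ws l), sum_prod_subsetWeight]
  have : r / m ≥ (1 : ℝ) - ∑ a : Sym2 (Fin n) → Fin r → Finset (Fin c),
      (∏ e, ∏ l, subsetWeight π (a e l)) *
        (if ∃ x, ∀ b ∈ colouredCopy H j x, ∃ l, b.2 ∈ a b.1 l then 1 else 0) := by
    nth_rewrite 1 [← hone]
    rw [ge_iff_le, ← sum_sub_distrib]
    refine le_trans (le_of_eq (sum_congr rfl fun a _ => ?_)) hspread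
    split_ifs <;> simp
  linarith

end Coordinates

/-! ### The law of the coloured random graph in terms of pair states. -/

section Law

variable {n : ℕ}

instance measurableSingletonClass_simpleGraph {V : Type*} [Countable V] :
    MeasurableSingletonClass (SimpleGraph V) where
  measurableSet_singleton G := by
    have : ({G} : Set (SimpleGraph V)) = SimpleGraph.edgeSet ⁻¹' {G.edgeSet} := by
      ext G'; simp
    rw [this]
    exact SimpleGraph.measurable_edgeSet (measurableSet_singleton _)

open Classical in
/-- The states of the pairs in a coloured graph. -/
noncomputable def pairStates {c : ℕ} (ω : SimpleGraph (Fin n) × (Sym2 (Fin n) → Fin c)) :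
    Sym2 (Fin n) → Bool × Fin c :=
  fun e => (decide (e ∈ ω.1.edgeSet), ω.2 e)

lemma pairStates_injective {c : ℕ} : Function.Injective (pairStates (n := n) (c := c)) := by
  rintro ⟨G, col⟩ ⟨G', col'⟩ h
  have h1 : ∀ e, (e ∈ G.edgeSet ↔ e ∈ G'.edgeSet) ∧ col e = col' e := fun e => by
    simpa [pairStates] using congrFun h e
  exact Prod.ext (SimpleGraph.edgeSet_injective (Set.ext fun e => (h1 e).1))
    (funext fun e => (h1 e).2)

lemma colouredBinomialRandom_real_singleton {c : ℕ} (hc : 0 < c) (p : unitInterval)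
    (ω : SimpleGraph (Fin n) × (Sym2 (Fin n) → Fin c)) :
    (colouredBinomialRandom n p c).real {ω} = ∏ e, pairWeight (p : ℝ) c e (pairStates ω e) := by
  classical
  obtain ⟨G, col⟩ := ω
  have : NeZero c := ⟨hc.ne'⟩
  have hprob : IsProbabilityMeasure (uniformOn (Set.univ : Set (Fin c))) :=
    isProbabilityMeasure_uniformOn Set.finite_univ Set.univ_nonempty
  have hcol : (uniformColouring n c).real {col} = ∏ _e : Sym2 (Fin n), (1 / c : ℝ) := by
    rw [uniformColouring, measureReal_def, Measure.pi_singleton, ENNReal.toReal_prod]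
    refine prod_congr rfl fun e _ => ?_
    rw [uniformOn_univ]
    simp
  have hG : (SimpleGraph.binomialRandom (Fin n) p).real {G} =
      ∏ e : Sym2 (Fin n), (if e.IsDiag then (if decide (e ∈ G.edgeSet) = true then 0 else 1)
        else (if decide (e ∈ G.edgeSet) = true then (p : ℝ) else 1 - p)) := by
    rw [measureReal_def, SimpleGraph.binomialRandom_singleton]
    have h1 : ∀ e : Sym2 (Fin n),
        (if e.IsDiag then (if decide (e ∈ G.edgeSet) = true then 0 else 1)
        else (if decide (e ∈ G.edgeSet) = true then (p : ℝ) else 1 - p)) =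
        (if e ∈ G.edgeFinset then (p : ℝ) else 1) *
          (if e ∈ ({e | ¬ e.IsDiag} : Finset (Sym2 (Fin n))) \ G.edgeFinset then 1 - (p : ℝ)
            else 1) := by
      intro e
      by_cases he : e ∈ G.edgeSet
      · have := G.not_isDiag_of_mem_edgeSet he
        simp [he, this]
      · by_cases hd : e.IsDiag <;> simp [he, hd]
    simp only [h1]
    rw [prod_mul_distrib, prod_ite_mem, prod_ite_mem, univ_inter, univ_inter, prod_const,
      prod_const, card_sdiff_of_subset, ← Set.ncard_coe_finset, SimpleGraph.coe_edgeFinset]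
    · have : #({e | ¬ e.IsDiag} : Finset (Sym2 (Fin n))) = n.choose 2 := by
        rw [← Fintype.card_subtype, Sym2.card_subtype_not_diag, Fintype.card_fin]
      rw [this]
      simp
    · intro e he
      rw [SimpleGraph.mem_edgeFinset] at he
      simpa using G.not_isDiag_of_mem_edgeSet he
  have hsf : SFinite (uniformColouring n c) := by
    rw [uniformColouring]; infer_instance
  rw [colouredBinomialRandom, ← Set.singleton_prod_singleton, measureReal_prod_prod, hG, hcol,
    ← prod_mul_distrib]
  rfl

-- States not coming from a coloured graph make some diagonal pair an edge, and these have weight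
-- zero.
open Classical in
lemma colouredBinomialRandom_real_pairStates {c : ℕ} (hc : 0 < c) (p : unitInterval)
    (P : (Sym2 (Fin n) → Bool × Fin c) → Prop) :
    (colouredBinomialRandom n p c).real {ω | P (pairStates ω)} =
      ∑ b, (∏ e, pairWeight (p : ℝ) c e (b e)) * (if P b then 1 else 0) := by
  have : NeZero c := ⟨hc.ne'⟩
  have hprob : IsProbabilityMeasure (uniformOn (Set.univ : Set (Fin c))) :=
    isProbabilityMeasure_uniformOn Set.finite_univ Set.univ_nonempty
  have hfin : IsFiniteMeasure (colouredBinomialRandom n p c) := by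
    rw [colouredBinomialRandom, uniformColouring]; infer_instance
  have hset : {ω | P (pairStates ω)} =
      (({ω | P (pairStates ω)} : Finset (SimpleGraph (Fin n) × (Sym2 (Fin n) → Fin c))) :
        Set (SimpleGraph (Fin n) × (Sym2 (Fin n) → Fin c))) := by simp
  rw [hset, ← sum_measureReal_singleton, sum_filter]
  refine Fintype.sum_of_injective pairStates pairStates_injective _ _ (fun b hb => ?_) fun ω => ?_
  · suffices h : ∃ e : Sym2 (Fin n), e.IsDiag ∧ (b e).1 = true by
      obtain ⟨e, he, hbe⟩ := h
      rw [prod_eq_zero (mem_univ e) (by simp [pairWeight, he, hbe]), zero_mul]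
    by_contra! h
    refine hb ⟨(SimpleGraph.fromEdgeSet {e | (b e).1 = true}, fun e => (b e).2), ?_⟩
    funext e
    refine Prod.ext ?_ rfl
    by_cases he : e.IsDiag
    · simp [pairStates, h e he, he]
    · simp [pairStates, he]
  · rw [colouredBinomialRandom_real_singleton hc]
    simp

end Law

/-! ### Maximum density and edges inside vertex sets. -/

section Density

variable {n : ℕ}

/-- Apply the density bound to the induced subgraph on `U`; empty `U` is separate, as its quotient
is `0 / 0`. -/
lemma two_mul_card_le_of_maxDensity_le {H : SimpleGraph (Fin n)} [DecidableRel H.Adj] {d : ℕ}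
    (hH : maxDensity H ≤ d) (U : Finset (Fin n)) :
    2 * #{e ∈ H.edgeFinset | ∀ x ∈ e, x ∈ U} ≤ d * #U := by
  classical
  set L := (⊤ : H.Subgraph).induce (U : Set (Fin n)) with hL
  have hle : 2 * (L.edgeSet.ncard : ℝ) / (L.verts.ncard : ℝ) ≤ d :=
    (le_ciSup (f := fun K : H.Subgraph => 2 * (K.edgeSet.ncard : ℝ) / (K.verts.ncard : ℝ))
      (Set.finite_range _).bddAbove L).trans hH
  have hverts : L.verts.ncard = #U := by
    rw [hL, SimpleGraph.Subgraph.induce_verts, Set.ncard_coe_finset]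
  have hedges : L.edgeSet.ncard = #{e ∈ H.edgeFinset | ∀ x ∈ e, x ∈ U} := by
    rw [← Set.ncard_coe_finset]
    congr 1
    ext e
    induction e with | h x y =>
    simp [hL]
    tauto
  rcases Nat.eq_zero_or_pos #U with h0 | hpos
  · have : ({e ∈ H.edgeFinset | ∀ x ∈ e, x ∈ U} : Finset _) = ∅ := by
      rw [card_eq_zero] at h0
      subst h0
      ext e
      induction e with | h x y =>
      simpa using fun _ => ⟨x, fun h => absurd rfl h⟩
    rw [this]
    simp
  · have hpos' : (0 : ℝ) < #U := by exact_mod_cast hpos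
    rw [hverts, hedges, div_le_iff₀ hpos'] at hle
    exact_mod_cast hle

end Density

/-! ### Comparison with the assumed edge probability. -/

section Asymptotics

open Filter Asymptotics

lemma eventually_log_pow_mul_rpow_le {d : ℕ} (hd : 0 < d) (B : ℝ) :
    ∀ᶠ n : ℕ in atTop, B * Real.log n ^ 3 * (n : ℝ) ^ (-(2 / ((d : ℝ) + 1))) ≤
      (n : ℝ) ^ (-(1 / (d : ℝ))) * Real.log n ^ (5 / (d : ℝ)) := by
  have hlog : Tendsto (fun n : ℕ => Real.log n) atTop atTop :=
    Real.tendsto_log_atTop.comp tendsto_natCast_atTop_atTop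
  rcases Nat.lt_or_ge d 2 with h | h
  · have : d = 1 := by omega
    subst this
    filter_upwards [hlog.eventually_ge_atTop (|B| + 1), eventually_gt_atTop 0] with n hn hn0
    have hn0' : (0 : ℝ) < n := by exact_mod_cast hn0
    have h1 : (-(2 / (((1 : ℕ) : ℝ) + 1)) : ℝ) = -1 := by norm_num
    have h2 : (-(1 / ((1 : ℕ) : ℝ)) : ℝ) = -1 := by norm_num
    have h3 : (5 / ((1 : ℕ) : ℝ) : ℝ) = (5 : ℕ) := by norm_num
    rw [h1, h2, h3, Real.rpow_natCast, mul_comm]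
    have hB := le_abs_self B
    have hB0 := abs_nonneg B
    have : B ≤ Real.log n ^ 2 := by nlinarith
    have h4 : B * Real.log n ^ 3 ≤ Real.log n ^ 2 * Real.log n ^ 3 :=
      mul_le_mul_of_nonneg_right this (pow_nonneg (by linarith) _)
    refine mul_le_mul_of_nonneg_left (h4.trans (le_of_eq (by ring))) (by positivity)
  · have hd' : (2 : ℝ) ≤ d := by exact_mod_cast h
    set δ : ℝ := 2 / ((d : ℝ) + 1) - 1 / d with hδ
    have hδ0 : 0 < δ := by
      rw [hδ, div_sub_div _ _ (by positivity) (by positivity)]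
      refine div_pos (by linarith) (by positivity)
    have hlo := ((isLittleO_log_rpow_rpow_atTop (3 : ℝ) hδ0).comp_tendsto
      (tendsto_natCast_atTop_atTop (R := ℝ))).bound (c := (|B| + 1)⁻¹) (by positivity)
    filter_upwards [hlog.eventually_ge_atTop 1, eventually_gt_atTop 0, hlo] with n hn hn0 hb
    have hn0' : (0 : ℝ) < n := by exact_mod_cast hn0
    simp only [Function.comp_apply] at hb
    rw [show (3 : ℝ) = ((3 : ℕ) : ℝ) by norm_num, Real.rpow_natCast,
      Real.norm_of_nonneg (by positivity),
      Real.norm_of_nonneg (by positivity), inv_mul_eq_div, le_div_iff₀ (by positivity)] at hb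
    have h1 : B * Real.log n ^ 3 ≤ (n : ℝ) ^ δ := by
      refine le_trans ?_ hb
      rw [mul_comm]
      exact mul_le_mul_of_nonneg_left (by linarith [le_abs_self B]) (by positivity)
    have h2 : (1 : ℝ) ≤ Real.log n ^ (5 / (d : ℝ)) := Real.one_le_rpow hn (by positivity)
    calc B * Real.log n ^ 3 * (n : ℝ) ^ (-(2 / ((d : ℝ) + 1)))
        ≤ (n : ℝ) ^ δ * (n : ℝ) ^ (-(2 / ((d : ℝ) + 1))) :=
          mul_le_mul_of_nonneg_right h1 (by positivity)
      _ = (n : ℝ) ^ (-(1 / (d : ℝ))) := by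
          rw [← Real.rpow_add hn0']
          congr 1
          rw [hδ]
          ring
      _ ≤ _ := le_mul_of_one_le_right (by positivity) h2

lemma eventually_exists_rounds {d : ℕ} (hd : 0 < d) (K : ℕ) {ε : ℝ} (hε : 0 < ε) :
    ∀ᶠ n : ℕ in atTop, 1 < n ∧ ∃ r : ℕ, 0 < r ∧ n ^ 2 < 2 ^ r ∧ ε ≤ r ∧
      108 * (r / ε) ^ 2 * (K : ℝ) ^ 2 * r * (n : ℝ) ^ (-(2 / ((d : ℝ) + 1))) ≤
        (n : ℝ) ^ (-(1 / (d : ℝ))) * Real.log n ^ (5 / (d : ℝ)) := by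
  have hlog : Tendsto (fun n : ℕ => Real.log n) atTop atTop :=
    Real.tendsto_log_atTop.comp tendsto_natCast_atTop_atTop
  filter_upwards [eventually_log_pow_mul_rpow_le hd (108 * 64 * (K : ℝ) ^ 2 / ε ^ 2),
    hlog.eventually_ge_atTop (1 + ε), eventually_gt_atTop 1] with n hn hnl hn1
  -- Here `r ≥ 3 log n` and `3 log 2 > 2`, so halving `r` times exhausts the fewer than `n²` edges.
  -- The parameter `m = r / ε` makes the failure bound `r / m` equal to `ε`, and `r³ ≤ 64 (log n)³`.
  refine ⟨hn1, ⌊4 * Real.log n⌋₊, ?_⟩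
  have hn0 : (0 : ℝ) < n := by exact_mod_cast (by omega : 0 < n)
  have h1 := Nat.floor_le (show 0 ≤ 4 * Real.log n by linarith)
  have h2 := Nat.lt_floor_add_one (4 * Real.log n)
  set r := ⌊4 * Real.log n⌋₊ with hr
  have hr0 : (0 : ℝ) < r := by linarith
  refine ⟨by exact_mod_cast hr0, ?_, by linarith, ?_⟩
  · have h3 : (n : ℝ) ^ 2 < 2 ^ r := by
      rw [← Real.log_lt_log_iff (by positivity) (by positivity), Real.log_pow, Real.log_pow]
      have := Real.log_two_gt_d9
      push_cast
      nlinarith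
    exact_mod_cast h3
  · refine le_trans (mul_le_mul_of_nonneg_right ?_ (by positivity)) hn
    have h3 : (r : ℝ) ^ 3 ≤ (4 * Real.log n) ^ 3 := pow_le_pow_left₀ hr0.le h1 3
    calc 108 * (r / ε) ^ 2 * (K : ℝ) ^ 2 * r = 108 * (K : ℝ) ^ 2 / ε ^ 2 * (r : ℝ) ^ 3 := by
          field_simp
      _ ≤ 108 * (K : ℝ) ^ 2 / ε ^ 2 * (4 * Real.log n) ^ 3 := by gcongr
      _ = _ := by ring

end Asymptotics

/-- An event of the states of the pairs that gives a rainbow copy. -/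
lemma hasRainbowCopy_of_pairStates {n c : ℕ} {H : SimpleGraph (Fin n)} [DecidableRel H.Adj]
    {j : Sym2 (Fin n) → Fin c} (hj : Set.InjOn j H.edgeSet)
    {ω : SimpleGraph (Fin n) × (Sym2 (Fin n) → Fin c)}
    {x : Equiv.Perm (Fin n) × Equiv.Perm (Fin c)}
    (hx : ∀ a ∈ colouredCopy H j x, (pairStates ω a.1).1 = true ∧ (pairStates ω a.1).2 = a.2) :
    HasRainbowCopy H ω.1 ω.2 := by
  have key : ∀ e ∈ H.edgeSet, e.map x.1 ∈ ω.1.edgeSet ∧ ω.2 (e.map x.1) = x.2 (j e) := by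
    intro e he
    have := hx (e.map x.1, x.2 (j e))
      (mem_image_of_mem _ (SimpleGraph.mem_edgeFinset.mpr he))
    simpa [pairStates] using this
  refine ⟨⟨⟨x.1, fun {u v} huv => ?_⟩, x.1.injective⟩, fun e he e' he' h => ?_⟩
  · simpa using (key s(u, v) huv).1
  · refine hj he he' (x.2.injective ?_)
    rw [← (key e he).2, ← (key e' he').2]
    exact h

lemma exists_injOn_edgeSet {n c : ℕ} (hc : 0 < c) (H : SimpleGraph (Fin n)) [DecidableRel H.Adj]
    (h : #H.edgeFinset ≤ c) : ∃ j : Sym2 (Fin n) → Fin c, Set.InjOn j H.edgeSet := by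
  obtain ⟨g⟩ : Nonempty (H.edgeFinset ↪ Fin c) :=
    Function.Embedding.nonempty_of_card_le (by rwa [Fintype.card_coe, Fintype.card_fin])
  refine ⟨fun e => if he : e ∈ H.edgeFinset then g ⟨e, he⟩ else ⟨0, hc⟩, fun e he e' he' hee => ?_⟩
  rw [← SimpleGraph.mem_edgeFinset] at he he'
  simpa [he, he'] using hee

end RainbowEmbedding

theorem theorem4 (α : ℝ) (hα : 0 < α) (Δ d : ℕ) (hd : 0 < d) (ε : ℝ) (hε : 0 < ε) :
    ∃ n₀ : ℕ, ∀ n : ℕ, n₀ ≤ n → ∀ H ∈ RainbowEmbedding.boundedFamily n Δ d,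
      ∀ p : unitInterval,
        (n : ℝ) ^ (-(1 / (d : ℝ))) * Real.log n ^ (5 / (d : ℝ)) ≤ (p : ℝ) →
      ∀ c : ℕ, 0 < c → |(c : ℝ) - (1 + α) * (H.edgeSet.ncard : ℝ)| < 1 →
        1 - ε ≤ (RainbowEmbedding.colouredBinomialRandom n p c).real
          {ω | RainbowEmbedding.HasRainbowCopy H ω.1 ω.2} := by
  classical
  -- The degree bound is taken as `Δ + 1` to be positive.
  obtain ⟨n₀, hn₀⟩ := Filter.eventually_atTop.mp
    (RainbowEmbedding.eventually_exists_rounds hd (Δ + 1) hε)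
  refine ⟨n₀, fun n hn H hH p hp c hc hcH => ?_⟩
  obtain ⟨hn1, r, hr0, hnr, hεr, hr⟩ := hn₀ n hn
  obtain ⟨hHΔ, hHd⟩ := hH
  have hncard : H.edgeSet.ncard = H.edgeFinset.card := by
    rw [← SimpleGraph.coe_edgeFinset, Set.ncard_coe_finset]
  -- Rounding loses less than 1, so `c > |E(H)| - 1`, and both sides are integers.
  have hle : H.edgeFinset.card ≤ c := by
    rw [hncard] at hcH
    have h1 : (H.edgeFinset.card : ℝ) < c + 1 := by
      have := (abs_lt.mp hcH).1
      nlinarith [mul_nonneg hα.le (Nat.cast_nonneg (α := ℝ) H.edgeFinset.card)]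
    have : H.edgeFinset.card < c + 1 := by exact_mod_cast h1
    omega
  obtain ⟨j, hj⟩ := RainbowEmbedding.exists_injOn_edgeSet hc H hle
  have hdeg : ∀ v, (Finset.univ.filter fun w => H.Adj v w).card ≤ Δ + 1 := by
    intro v
    have h1 : H.degree v ≤ Δ := by
      refine (H.degree_le_maxDegree v).trans ?_
      convert hHΔ
    rw [← SimpleGraph.card_neighborFinset_eq_degree, SimpleGraph.neighborFinset_eq_filter] at h1
    omega
  have hlogpos : 0 < Real.log n := Real.log_pos (by exact_mod_cast hn1)
  have hn0 : (0 : ℝ) < n := by exact_mod_cast (by omega : 0 < n)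
  have hp0 : 0 < (p : ℝ) := lt_of_lt_of_le (by positivity) hp
  have hedges : H.edgeFinset.card < 2 ^ r := by
    refine lt_of_le_of_lt ?_ hnr
    have := H.card_edgeFinset_le_card_choose_two
    rw [Fintype.card_fin] at this
    refine this.trans ?_
    rw [Nat.choose_two_right, sq]
    exact (Nat.div_le_self _ _).trans (Nat.mul_le_mul_left _ (Nat.sub_le _ _))
  have hmain := RainbowEmbedding.one_sub_le_sum_pairWeight (by omega) hc H (by omega : 1 ≤ Δ + 1)
    hdeg (fun U => by convert RainbowEmbedding.two_mul_card_le_of_maxDensity_le hHd U) hj hp0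
    p.2.2 (m := r / ε) (by rw [le_div_iff₀ hε]; linarith) hr0 hedges (hr.trans hp)
  have hr0' : (r : ℝ) ≠ 0 := by exact_mod_cast hr0.ne'
  rw [div_div_cancel₀ hr0'] at hmain
  have hlaw := RainbowEmbedding.colouredBinomialRandom_real_pairStates hc p fun b =>
    ∃ x, ∀ a ∈ RainbowEmbedding.colouredCopy H j x, (b a.1).1 = true ∧ (b a.1).2 = a.2
  replace hmain := hmain.trans_eq (Eq.trans (by congr!) hlaw.symm)
  have : NeZero c := ⟨hc.ne'⟩
  have hprob : IsProbabilityMeasure (uniformOn (Set.univ : Set (Fin c))) :=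
    isProbabilityMeasure_uniformOn Set.finite_univ Set.univ_nonempty
  have hfin : IsFiniteMeasure (RainbowEmbedding.colouredBinomialRandom n p c) := by
    rw [RainbowEmbedding.colouredBinomialRandom, RainbowEmbedding.uniformColouring]; infer_instance
  refine hmain.trans (measureReal_mono ?_)
  rintro ω ⟨x, hx⟩
  exact RainbowEmbedding.hasRainbowCopy_of_pairStates hj hx
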